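/- Let $b\ge 2$ be an integer, $\alpha=\frac1b$, and $\gamma\in\,]0,1[$. Let $\vec\Lambda\subset\mathbb C$ be a unimodular $\mathbb Z$-lattice (a discrete additive subgroup spanning $\mathbb C$ over $\mathbb R$, of covolume $1$), let $z_0\in\mathbb C$, and let $\Lambda=z_0+\vec\Lambda$ be the corresponding unimodular grid. For $N\in\mathbb N$ put $$\mathcal R_N=\frac{\alpha}{N^{2(2-\alpha-\gamma)}}\sum_{\substack{n,m\in\Lambda,\ n\ne m\\ 0<|n|,|m|\le N}}\ \sum_{\substack{u,v\in\mathbb C^*\\ u^b=m,\ v^b=n}}\Delta_{N^\gamma(v-u)},$$ where $\Delta_z$ is the Dirac mass at $z$, and let $\rho=\rho_{\alpha,\gamma,\vec\Lambda}:\mathbb C\to[0,+\infty[$ be given by $$\rho(z)=\begin{cases}0&\text{if }\gamma>1-\alpha,\\[1mm] \dfrac{\pi}{\alpha^2(2-\alpha)}&\text{if }\gamma<1-\alpha,\\[2mm] \dfrac{\alpha^{\frac{2}{1-\alpha}}}{1-\alpha}\,|z|^{-\frac{4-2\alpha}{1-\alpha}}\displaystyle\sum_{p\in\vec\Lambda,\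 |p|\le |z|/\alpha}|p|^{\frac{2}{1-\alpha}}&\text{if }\gamma=1-\alpha\end{cases}$$ (with $\rho(0)=0$ in the last case). Then the measures $\mathcal R_N$ and $\rho\,\mathrm{Leb}_{\mathbb C}$ are locally finite and, as $N\to\infty$, $\mathcal R_N$ converges vaguely to $\rho\,\mathrm{Leb}_{\mathbb C}$: for every continuous compactly supported $f:\mathbb C\to\mathbb C$, $\int f\,d\mathcal R_N\to\int f\,d(\rho\,\mathrm{Leb}_{\mathbb C})$. Moreover, suppose $\gamma=1-\alpha$. (Level repulsion) The number $\mathrm{sys}_{\vec\Lambda}=\inf\{|p|:p\in\vec\Lambda,\ p\ne0\}$ is positive and $\rho(z)=0$ whenever $|z|<\alpha\,\mathrm{sys}_{\vec\Lambda}$. (Rate of convergence) There is a constant $C>0$ depending only on $\alpha$ and $\Lambda$ such that for every real $A>1$ there is $N_0\in\mathbb N$, depending only on $\alpha,\Lambda,A$, such that for every continuously (real) differentiable $f:\mathbb C\to\mathbb C$ with compact support contained in the open disk $D(0,A)$ and every $N\ge N_0$, $$\Big|\int f\,d\mathcal R_N-\int_{\mathbb C}f(z)\rho(z)\,dz\Big|\le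 C\,\frac{A^4\,(\|f\|_\infty+\|df\|_\infty)}{N},$$ where $\|f\|_\infty=\sup_z|f(z)|$ and $\|df\|_\infty=\sup_z\|df(z)\|$ with the operator norm on $\mathbb R$-linear maps $\mathbb C\to\mathbb C$. -/

import Mathlib

open MeasureTheory Filter Topology

noncomputable section

namespace RootPairs

/-- The grid `z₀ + L` with underlying lattice `L`. -/
def grid (L : Submodule ℤ ℂ) (z₀ : ℂ) : Set ℂ := {z | ∃ p ∈ L, z = z₀ + p}

/-- The ordered pairs `(n, m)` of distinct nonzero points of `S` of modulus at most `N`. -/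
def PointPair (S : Set ℂ) (N : ℕ) : Type :=
  {x : ℂ × ℂ // x.1 ∈ S ∧ x.2 ∈ S ∧ x.1 ≠ x.2 ∧
    0 < ‖x.1‖ ∧ ‖x.1‖ ≤ N ∧ 0 < ‖x.2‖ ∧ ‖x.2‖ ≤ N}

/-- The pairs `(u, v)` of nonzero complex numbers with `u ^ b = m` and `v ^ b = n`. -/
def RootPair (b : ℕ) (n m : ℂ) : Type :=
  {w : ℂ × ℂ // w.1 ≠ 0 ∧ w.2 ≠ 0 ∧ w.1 ^ b = m ∧ w.2 ^ b = n}

/-- The empirical pair correlation measure of the `b`-th roots of the points of `S`, with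
`α = 1 / b` and scaling exponent `γ`:
`α / N ^ (2 (2 - α - γ))` times the sum, over all `n ≠ m` in `S` with `0 < |n|, |m| ≤ N` and all
`u, v` with `u ^ b = m` and `v ^ b = n`, of the Dirac masses at `N ^ γ (v - u)`. -/
def empiricalMeasure (b : ℕ) (γ : ℝ) (S : Set ℂ) (N : ℕ) : Measure ℂ :=
  ENNReal.ofReal ((1 / (b : ℝ)) / (N : ℝ) ^ (2 * (2 - 1 / (b : ℝ) - γ))) •
    Measure.sum fun x : PointPair S N =>
      Measure.sum fun w : RootPair b x.1.1 x.1.2 =>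
        Measure.dirac ((((N : ℝ) ^ γ : ℝ) : ℂ) * (w.1.2 - w.1.1))

/-- The limit density `ρ` attached to `α`, `γ` and the (unimodular) lattice `L`. The sum in the
last case is over the finitely many lattice points of modulus at most `|z| / α`. -/
def density (α γ : ℝ) (L : Submodule ℤ ℂ) (z : ℂ) : ℝ :=
  if 1 - α < γ then 0
  else if γ < 1 - α then Real.pi / (α ^ 2 * (2 - α))
  else α ^ (2 / (1 - α)) / (1 - α) * ‖z‖ ^ (-((4 - 2 * α) / (1 - α))) *
    ∑' p : {p : ℂ // p ∈ L ∧ ‖p‖ ≤ ‖z‖ / α}, ‖p.1‖ ^ (2 / (1 - α))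

/-- The limit measure `ρ · Leb`. -/
def limitMeasure (α γ : ℝ) (L : Submodule ℤ ℂ) : Measure ℂ :=
  volume.withDensity fun z => ENNReal.ofReal (density α γ L z)

/-- Vague convergence of Radon (that is, locally finite Borel) measures on `ℂ`. -/
def VaguelyConverges (μ : ℕ → Measure ℂ) (ν : Measure ℂ) : Prop :=
  (∀ N, IsLocallyFiniteMeasure (μ N)) ∧ IsLocallyFiniteMeasure ν ∧
    ∀ f : ℂ → ℂ, Continuous f → HasCompactSupport f →
      Tendsto (fun N => ∫ z, f z ∂(μ N)) atTop (𝓝 (∫ z, f z ∂ν))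

/-- The systole: the least modulus of a nonzero lattice point. -/
def systole (L : Submodule ℤ ℂ) : ℝ := sInf {r : ℝ | ∃ p ∈ L, p ≠ 0 ∧ r = ‖p‖}

end RootPairs

end

/-!
# Pair correlations of roots of lattice points

Put `α = 1 / b`, `β = 1 / (1 - α) = b / (b - 1)` and `ε = N ^ (γ - (1 - α))`. If `u ^ b = m` and
`v ^ b = m + p` with `v` close to `u`, then `v - u` is `p / (b u ^ (b - 1))` up to second order.
After scaling by `N ^ γ` the pair of roots contributes a Dirac mass near
`N ^ γ p / (b u ^ (b - 1))`, where `p` runs through the nonzero points of the lattice. For fixed `p`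
the sum over `m` is a Riemann sum of an integral over the disk of radius `N`, and polar coordinates
turn that integral into the integral of the test function against an explicit radial density
proportional to `‖p‖ ^ (2 β) ‖z‖ ^ (- 2 β - 2)` on `‖z‖ ≥ ε ‖p‖ / b`. Summing over `p` gives exactly
`ρ (z / ε)`, where `ρ` is the limit density at the critical exponent `γ = 1 - α`.

All cases of the theorem follow from one estimate, `exists_norm_pairCorrelation_sub_le`: for test
functions supported in the disk of radius `A`, the pair correlation sum differs from the integral
against `ρ (z / ε)` by `O(A ^ 4 / (N ε))`. At the critical exponent `ε = 1`, which is the rate of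
convergence. If `γ < 1 - α` then `ε` tends to `0` and `ρ` tends to the constant density at infinity
(`tendsto_density_critical`); if `γ > 1 - α` then `ε` tends to infinity and `ρ` vanishes near `0`
(`density_critical_eq_zero`).

The errors are controlled as follows. A pair `(m, m + p)` contributes only if
`N / ‖m‖ ≤ (2 b A / (ε ‖p‖)) ^ 2` (`pow_div_pow_le_of_lt`); then the second order error of the
linearisation (`exists_norm_sum_roots_sub_le`) and the variation of the linearised sum on a cell of
the lattice (`norm_linRootSum_sub_le`) are both `O(A ^ 3 / (N ε ^ 2 ‖p‖))`. The sum of `1 / ‖p‖`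
over the lattice points with `ε ‖p‖ ≤ 2 b A` is `O(A / ε)`, which produces the exponent `4`. To
treat continuous functions and `C¹` functions at once, test functions are only required to satisfy
`‖f z - f w‖ ≤ η + K ‖z - w‖` (`IsTestFunction`).
-/

namespace RootPairs

/-! ### Roots of complex numbers near a given root -/

theorem exists_le_norm_root_of_unity_sub_one (b : ℕ) (hb : 0 < b) :
    ∃ δ : ℝ, 0 < δ ∧ ∀ ω : ℂ, ω ^ b = 1 → ω ≠ 1 → δ ≤ ‖ω - 1‖ := by
  have hfin : ((Polynomial.nthRootsFinset b (1 : ℂ)).erase 1 : Set ℂ).Finite :=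
    Finset.finite_toSet _
  have hmem : ((Polynomial.nthRootsFinset b (1 : ℂ)).erase 1 : Set ℂ)ᶜ ∈ 𝓝 (1 : ℂ) :=
    hfin.isClosed.isOpen_compl.mem_nhds (by simp)
  obtain ⟨δ, hδ, hball⟩ := Metric.mem_nhds_iff.1 hmem
  refine ⟨δ, hδ, fun ω hω h1 => ?_⟩
  by_contra! h
  have := hball (show ω ∈ Metric.ball 1 δ by simpa [dist_eq_norm] using h)
  apply this
  simp [Polynomial.mem_nthRootsFinset hb, hω, h1]

/-- The principal `b`-th root of `1 + t`, expanded to second order at `t = 0`. -/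
theorem exists_root_one_add (b : ℕ) (hb : 2 ≤ b) (t : ℂ) (ht : ‖t‖ ≤ 1 / 2) :
    ∃ τ : ℂ, τ ^ b = 1 + t ∧ ‖τ - 1 - t / b‖ ≤ 2 * ‖t‖ ^ 2 := by
  have hb' : (2 : ℝ) ≤ b := by exact_mod_cast hb
  have hb0 : (b : ℂ) ≠ 0 := by exact_mod_cast (by omega : b ≠ 0)
  have h1t : 1 + t ≠ 0 := by
    intro h
    have : t = -1 := by linear_combination h
    rw [this] at ht
    norm_num at ht
  have hlog := Complex.norm_log_one_add_sub_self_le (z := t) (by linarith)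
  have hlog' := Complex.norm_log_one_add_half_le_self ht
  set ℓ := Complex.log (1 + t)
  have hinv : (1 - ‖t‖)⁻¹ ≤ 2 := by
    rw [inv_le_comm₀ (by linarith) (by norm_num)]
    linarith
  have hℓ : ‖ℓ - t‖ ≤ ‖t‖ ^ 2 := by
    refine hlog.trans ?_
    nlinarith [sq_nonneg ‖t‖]
  have hbinv : ‖(b : ℂ)‖⁻¹ ≤ 1 / 2 := by
    rw [Complex.norm_natCast, inv_le_comm₀ (by linarith) (by norm_num)]
    simpa using hb'
  have hdiv (z : ℂ) : ‖z / b‖ ≤ ‖z‖ / 2 := by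
    rw [norm_div, div_eq_mul_inv]
    nlinarith [norm_nonneg z]
  have hn := norm_nonneg t
  have hs : ‖ℓ / b‖ ≤ ‖t‖ := (hdiv ℓ).trans (by linarith)
  refine ⟨Complex.exp (ℓ / b), ?_, ?_⟩
  · rw [← Complex.exp_nat_mul, mul_div_cancel₀ _ hb0, Complex.exp_log h1t]
  · have h2 := Complex.norm_exp_sub_one_sub_id_le (x := ℓ / b) (by linarith)
    have h3 := hdiv (ℓ - t)
    have : Complex.exp (ℓ / b) - 1 - t / b
        = (Complex.exp (ℓ / b) - 1 - ℓ / b) + (ℓ - t) / b := by ring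
    rw [this]
    refine (norm_add_le _ _).trans ?_
    have h4 : ‖ℓ / b‖ ^ 2 ≤ ‖t‖ ^ 2 := by gcongr
    nlinarith [sq_nonneg ‖t‖]

theorem exists_root_one_add_inv_pow (b : ℕ) (hb : 2 ≤ b) (t : ℂ) (ht : ‖t‖ ≤ 1 / 6) :
    ∃ τ : ℂ, τ ^ b = 1 + t ∧ τ ≠ 0 ∧ ‖(τ ^ (b - 1))⁻¹ - 1‖ ≤ 3 * ‖t‖ := by
  have hb' : (2 : ℝ) ≤ b := by exact_mod_cast hb
  have hb0 : (b : ℂ) ≠ 0 := by exact_mod_cast (by omega : b ≠ 0)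
  have h1t : 1 + t ≠ 0 := by
    intro h
    have : t = -1 := by linear_combination h
    rw [this] at ht
    norm_num at ht
  have hlog' := Complex.norm_log_one_add_half_le_self (z := t) (by linarith)
  set ℓ := Complex.log (1 + t)
  refine ⟨Complex.exp (ℓ / b), ?_, Complex.exp_ne_zero _, ?_⟩
  · rw [← Complex.exp_nat_mul, mul_div_cancel₀ _ hb0, Complex.exp_log h1t]
  · rw [← Complex.exp_nat_mul, ← Complex.exp_neg]
    have hs : ‖-(((b - 1 : ℕ) : ℂ) * (ℓ / b))‖ ≤ ‖ℓ‖ := by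
      rw [norm_neg, norm_mul, norm_div, Complex.norm_natCast, Complex.norm_natCast,
        Nat.cast_sub (by omega)]
      rw [mul_div_assoc', div_le_iff₀ (by linarith)]
      push_cast
      nlinarith [norm_nonneg ℓ]
    refine (Complex.norm_exp_sub_one_le (by linarith)).trans ?_
    linarith

/-- For small `t`, the principal root `τ` of `1 + t` is the only `b`-th root of `1 + t` which can be
within distance `c` of `1`; for the other `t` there is none. -/
theorem exists_unique_root_near_one (b : ℕ) (hb : 2 ≤ b) :
    ∃ t₀ c : ℝ, 0 < t₀ ∧ t₀ ≤ 1 / 6 ∧ 0 < c ∧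
      (∀ t : ℂ, ‖t‖ ≤ t₀ → ∃ τ : ℂ, τ ^ b = 1 + t ∧ ‖τ - 1 - t / b‖ ≤ 2 * ‖t‖ ^ 2 ∧
        ‖t‖ / (2 * b) ≤ ‖τ - 1‖ ∧ ∀ w : ℂ, w ^ b = 1 + t → w ≠ τ → c ≤ ‖w - 1‖) ∧
      ∀ w : ℂ, t₀ ≤ ‖w ^ b - 1‖ → c ≤ ‖w - 1‖ := by
  obtain ⟨δ, hδ, hsep⟩ := exists_le_norm_root_of_unity_sub_one b (by omega)
  have hb' : (2 : ℝ) ≤ b := by exact_mod_cast hb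
  -- `4 b t₀ ≤ 1` makes the first order term of the expansion dominate, and `4 t₀ ≤ δ` keeps the
  -- other roots away from `1`.
  obtain ⟨t₀, ht₀, h6, hbt, hδt⟩ : ∃ t₀ : ℝ, 0 < t₀ ∧ t₀ ≤ 1 / 6 ∧ 4 * b * t₀ ≤ 1 ∧
      4 * t₀ ≤ δ := by
    refine ⟨min (min (1 / 6 : ℝ) (1 / (4 * (b : ℝ)))) (δ / 4), by positivity, ?_, ?_, ?_⟩
    · exact (min_le_left _ _).trans (min_le_left _ _)
    · have : min (min (1 / 6 : ℝ) (1 / (4 * (b : ℝ)))) (δ / 4) ≤ 1 / (4 * (b : ℝ)) :=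
        (min_le_left _ _).trans (min_le_right _ _)
      rw [le_div_iff₀ (by positivity)] at this
      linarith
    · have := min_le_right (min (1 / 6 : ℝ) (1 / (4 * (b : ℝ)))) (δ / 4)
      linarith
  have hcont : Tendsto (fun w : ℂ => ‖w ^ b - 1‖) (𝓝 1) (𝓝 0) := by
    have : Continuous fun w : ℂ => ‖w ^ b - 1‖ := by fun_prop
    simpa using this.tendsto 1
  obtain ⟨c₁, hc₁, hball⟩ := Metric.eventually_nhds_iff.1 (hcont.eventually_lt_const ht₀)
  refine ⟨t₀, min c₁ (δ / 2), ht₀, h6, by positivity, fun t ht => ?_, fun w hw => ?_⟩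
  · obtain ⟨τ, hτ, h2⟩ := exists_root_one_add b hb t (by linarith)
    have hn := norm_nonneg t
    have hbn : ‖t / (b : ℂ)‖ = ‖t‖ / b := by simp
    have htd : ‖t‖ / (2 * b) = ‖t‖ / b / 2 := by field_simp
    have hsq : 2 * ‖t‖ ^ 2 ≤ ‖t‖ / (2 * b) := by
      rw [le_div_iff₀ (by positivity)]
      have : 4 * b * ‖t‖ ≤ 1 := le_trans (by gcongr) hbt
      nlinarith
    have hup : ‖t‖ / b ≤ ‖t‖ / 2 := by gcongr
    have e1 : τ - 1 = (τ - 1 - t / b) + t / b := by ring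
    have hlo : ‖t‖ / (2 * b) ≤ ‖τ - 1‖ := by
      have := norm_sub_le_norm_add (t / (b : ℂ)) (τ - 1 - t / b)
      rw [show t / (b : ℂ) + (τ - 1 - t / b) = τ - 1 by ring] at this
      linarith
    have hhi : ‖τ - 1‖ ≤ ‖t‖ := by
      rw [e1]
      refine (norm_add_le _ _).trans ?_
      linarith
    refine ⟨τ, hτ, h2, hlo, fun w hw hne => (min_le_right _ _).trans ?_⟩
    have hτ0 : τ ≠ 0 := by
      rintro rfl
      have : t = -1 := by
        rw [zero_pow (by omega)] at hτ
        linear_combination -hτ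
      rw [this, norm_neg, norm_one] at ht
      linarith
    have hω := hsep (w / τ) (by rw [div_pow, hw, ← hτ, div_self (pow_ne_zero _ hτ0)])
      (by rwa [ne_eq, div_eq_one_iff_eq hτ0])
    have h5 : w - 1 = τ * (w / τ - 1) + (τ - 1) := by field_simp; ring
    have h6' : 1 - ‖τ - 1‖ ≤ ‖τ‖ := by
      have := norm_sub_norm_le (1 : ℂ) (1 - τ)
      rw [norm_one, norm_sub_rev 1 τ] at this
      simpa using this
    have h7 := norm_sub_le_norm_add (τ * (w / τ - 1)) (τ - 1)
    rw [← h5, norm_mul] at h7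
    have h8 : 5 / 6 * δ ≤ ‖τ‖ * ‖w / τ - 1‖ := by
      apply mul_le_mul (by linarith) hω hδ.le (norm_nonneg _)
    linarith
  · refine (min_le_left _ _).trans ?_
    by_contra! h
    have := hball (y := w) (by rwa [dist_eq_norm])
    linarith

/-- Multiplication by a `b`-th root of `y / x` carries the `b`-th roots of `x` to those of `y`. -/
theorem sum_nthRootsFinset_mul {E : Type*} [AddCommMonoid E] {b : ℕ} (hb : 0 < b) {x y τ : ℂ}
    (hτ : τ ≠ 0) (hxy : y = x * τ ^ b) (g : ℂ → E) :
    ∑ u ∈ Polynomial.nthRootsFinset b y, g u = ∑ u ∈ Polynomial.nthRootsFinset b x, g (u * τ) := by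
  refine Finset.sum_bij' (fun u _ => u / τ) (fun u _ => u * τ) ?_ ?_ ?_ ?_ ?_
  · intro u hu
    rw [Polynomial.mem_nthRootsFinset hb] at hu ⊢
    rw [div_pow, hu, hxy, mul_div_cancel_right₀ _ (pow_ne_zero _ hτ)]
  · intro u hu
    rw [Polynomial.mem_nthRootsFinset hb] at hu ⊢
    rw [mul_pow, hu, hxy]
  · intro u _
    exact div_mul_cancel₀ _ hτ
  · intro u _
    exact mul_div_cancel_right₀ _ hτ
  · intro u _
    rw [div_mul_cancel₀ _ hτ]

theorem card_nthRootsFinset_le (b : ℕ) (x : ℂ) : (Polynomial.nthRootsFinset b x).card ≤ b := by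
  classical
  rw [Polynomial.nthRootsFinset_def]
  exact (Multiset.toFinset_card_le _).trans (Polynomial.card_nthRoots b x)

section

/-! ### Test functions and the linearised root sum -/

/-- Continuous functions bounded by `M`, vanishing outside the open disk of radius `A`, and
satisfying `‖f z - f w‖ ≤ η + K * ‖z - w‖`. Taking `η = 0` gives Lipschitz functions; conversely
every continuous compactly supported function qualifies with `η` arbitrarily small, at the price of
a large `K`. -/
structure IsTestFunction (f : ℂ → ℂ) (A M K η : ℝ) : Prop where
  continuous : Continuous f
  norm_le : ∀ z, ‖f z‖ ≤ M
  eq_zero : ∀ z, A ≤ ‖z‖ → f z = 0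
  norm_sub_le : ∀ z w, ‖f z - f w‖ ≤ η + K * ‖z - w‖
  K_nonneg : 0 ≤ K
  η_nonneg : 0 ≤ η

/-- The sum of `f (a p / (b u ^ (b - 1)))` over the `b`-th roots `u` of `x`. The argument is the
first order approximation in `p` of `a (v - u)`, for `v` the root of `x + p` close to `u`. -/
noncomputable def linRootSum (b : ℕ) (f : ℂ → ℂ) (a : ℝ) (p x : ℂ) : ℂ :=
  ∑ u ∈ Polynomial.nthRootsFinset b x, f ((a : ℂ) * p / (b * u ^ (b - 1)))

variable {f : ℂ → ℂ} {A M K η : ℝ}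

theorem IsTestFunction.M_nonneg (hf : IsTestFunction f A M K η) : 0 ≤ M :=
  (norm_nonneg _).trans (hf.norm_le 0)

theorem norm_linearised_arg {b : ℕ} {a : ℝ} (ha : 0 < a) (p u : ℂ) :
    ‖(a : ℂ) * p / (b * u ^ (b - 1))‖ = a * ‖p‖ / (b * ‖u‖ ^ (b - 1)) := by
  simp [abs_of_pos ha]

theorem norm_linRootSum_le (hf : IsTestFunction f A M K η) (b : ℕ) (a : ℝ) (p x : ℂ) :
    ‖linRootSum b f a p x‖ ≤ b * M := by
  refine (norm_sum_le_of_le _ (fun u _ => hf.norm_le _)).trans ?_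
  rw [Finset.sum_const, nsmul_eq_mul]
  gcongr
  · exact hf.M_nonneg
  · exact card_nthRootsFinset_le b x

theorem linRootSum_eq_zero (hf : IsTestFunction f A M K η) {b : ℕ} (hb : 2 ≤ b) {a : ℝ}
    (ha : 0 < a) {p x : ℂ} (hx : x ≠ 0)
    (h : ∀ r : ℝ, 0 < r → r ^ b = ‖x‖ → b * A * r ^ (b - 1) ≤ a * ‖p‖) :
    linRootSum b f a p x = 0 := by
  refine Finset.sum_eq_zero fun u hu => hf.eq_zero _ ?_
  rw [Polynomial.mem_nthRootsFinset (by omega)] at hu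
  have hu0 : 0 < ‖u‖ := by
    rw [norm_pos_iff]
    rintro rfl
    rw [zero_pow (by omega)] at hu
    exact hx hu.symm
  have hb' : (0 : ℝ) < b := by exact_mod_cast (by omega : 0 < b)
  rw [norm_linearised_arg ha, le_div_iff₀ (by positivity)]
  have := h ‖u‖ hu0 (by rw [← hu, norm_pow])
  linarith

/-- Replacing the roots `v` of `u ^ b + p` by their linearisation: at most one of them contributes,
and it is within second order of `u + p / (b u ^ (b - 1))`. -/
theorem exists_norm_sum_roots_sub_le (b : ℕ) (hb : 2 ≤ b) :
    ∃ κ : ℝ, 0 < κ ∧ ∀ (f : ℂ → ℂ) (A M K η a : ℝ) (u p : ℂ), IsTestFunction f A M K η →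
      0 ≤ A → 0 < a → u ≠ 0 → κ * A ≤ a * ‖u‖ →
      ‖∑ v ∈ Polynomial.nthRootsFinset b (u ^ b + p), f (a * (v - u)) -
          f (a * p / (b * u ^ (b - 1)))‖ ≤
        if a * ‖p‖ < 2 * b * A * ‖u‖ ^ (b - 1) then η + 4 * b * K * A * (‖p‖ / ‖u‖ ^ b) else 0 := by
  obtain ⟨t₀, c, ht₀, -, hc, hnear, hfar⟩ := exists_unique_root_near_one b hb
  have hb0 : (0 : ℝ) < b := by exact_mod_cast (by omega : 0 < b)
  have hbC : (b : ℂ) ≠ 0 := by exact_mod_cast (by omega : b ≠ 0)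
  refine ⟨1 / c + b / t₀, by positivity, fun f A M K η a u p hf hA ha hu hκ => ?_⟩
  have hun : 0 < ‖u‖ := norm_pos_iff.2 hu
  have hK := hf.K_nonneg
  have hη := hf.η_nonneg
  have hcA : A ≤ a * ‖u‖ * c := by
    have : 1 / c * A ≤ a * ‖u‖ := le_trans (by gcongr; simp; positivity) hκ
    rwa [one_div_mul_eq_div, div_le_iff₀ hc] at this
  have htA : b * A ≤ a * ‖u‖ * t₀ := by
    have : b / t₀ * A ≤ a * ‖u‖ := le_trans (by gcongr; simp; positivity) hκ
    rwa [div_mul_eq_mul_div, div_le_iff₀ ht₀] at this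
  set t := p / u ^ b with ht
  have hub : u ^ b = u * u ^ (b - 1) := by
    rw [← pow_succ']
    congr 1
    omega
  have hubn : ‖u‖ ^ b = ‖u‖ * ‖u‖ ^ (b - 1) := by
    rw [← norm_pow, hub, norm_mul, norm_pow]
  have hp : p = u ^ b * t := by rw [ht, mul_div_cancel₀ _ (pow_ne_zero _ hu)]
  have harg : (a : ℂ) * p / (b * u ^ (b - 1)) = a * u * (t / b) := by
    rw [hp, hub]
    field_simp
  have htn : ‖t‖ = ‖p‖ / ‖u‖ ^ b := by rw [ht, norm_div, norm_pow]
  have hargn (z : ℂ) : ‖(a : ℂ) * u * z‖ = a * ‖u‖ * ‖z‖ := by simp [abs_of_pos ha]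
  have hroot (v : ℂ) (hv : v ^ b = u ^ b + p) : (v / u) ^ b = 1 + t := by
    rw [div_pow, hv, add_div, div_self (pow_ne_zero _ hu)]
  have hsub (v : ℂ) : (a : ℂ) * (v - u) = a * u * (v / u - 1) := by field_simp
  have hvanish (v : ℂ) (h : c ≤ ‖v / u - 1‖) : f (a * (v - u)) = 0 := by
    apply hf.eq_zero
    rw [hsub, hargn]
    exact hcA.trans (by gcongr)
  have hrhs : 0 ≤ if a * ‖p‖ < 2 * b * A * ‖u‖ ^ (b - 1) then
      η + 4 * b * K * A * (‖p‖ / ‖u‖ ^ b) else 0 := by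
    split_ifs <;> positivity
  by_cases htt : ‖t‖ ≤ t₀
  · obtain ⟨τ, hτ, h2, hlo, huniq⟩ := hnear t htt
    have hsum : ∑ v ∈ Polynomial.nthRootsFinset b (u ^ b + p), f (a * (v - u)) =
        f (a * u * (τ - 1)) := by
      rw [Finset.sum_eq_single (u * τ)]
      · rw [hsub, mul_div_cancel_left₀ _ hu]
      · intro v hv hne
        rw [Polynomial.mem_nthRootsFinset (by omega)] at hv
        refine hvanish v (huniq _ (hroot v hv) ?_)
        rintro rfl
        exact hne (mul_div_cancel₀ _ hu).symm
      · intro h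
        refine absurd ?_ h
        rw [Polynomial.mem_nthRootsFinset (by omega), mul_pow, hτ, hp]
        ring
    rw [hsum, harg]
    split_ifs with hcond
    · refine (hf.norm_sub_le _ _).trans ?_
      rw [← mul_sub, hargn]
      have h3 : a * ‖u‖ * ‖t‖ ≤ 2 * b * A := by
        rw [htn, hubn]
        rw [show a * ‖u‖ * (‖p‖ / (‖u‖ * ‖u‖ ^ (b - 1))) = a * ‖p‖ / ‖u‖ ^ (b - 1) by field_simp,
          div_le_iff₀ (by positivity)]
        exact hcond.le
      have h4 : a * ‖u‖ * ‖τ - 1 - t / b‖ ≤ a * ‖u‖ * (2 * ‖t‖ ^ 2) := by gcongr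
      rw [← htn]
      have h5 : a * ‖u‖ * (2 * ‖t‖ ^ 2) ≤ 4 * b * A * ‖t‖ := by nlinarith [norm_nonneg t]
      nlinarith
    · push Not at hcond
      have h3 : 2 * b * A ≤ a * ‖u‖ * ‖t‖ := by
        rw [htn, hubn]
        rw [show a * ‖u‖ * (‖p‖ / (‖u‖ * ‖u‖ ^ (b - 1))) = a * ‖p‖ / ‖u‖ ^ (b - 1) by field_simp,
          le_div_iff₀ (by positivity)]
        exact hcond
      have h4 : A ≤ a * ‖u‖ * (‖t‖ / (2 * b)) := by
        rw [mul_div_assoc', le_div_iff₀ (by positivity)]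
        linarith
      rw [hf.eq_zero (a * u * (τ - 1)), hf.eq_zero (a * u * (t / b))]
      · simp
      · rw [hargn]
        refine h4.trans ?_
        rw [norm_div t, Complex.norm_natCast]
        gcongr
        linarith
      · rw [hargn]
        exact h4.trans (by gcongr)
  · push Not at htt
    rw [Finset.sum_eq_zero, harg, hf.eq_zero (a * u * (t / b))]
    · simpa using hrhs
    · rw [hargn, norm_div t, Complex.norm_natCast, mul_div_assoc', le_div_iff₀ hb0]
      calc A * b ≤ a * ‖u‖ * t₀ := by linarith
        _ ≤ _ := by gcongr
    · intro v hv
      rw [Polynomial.mem_nthRootsFinset (by omega)] at hv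
      refine hvanish v (hfar _ ?_)
      rw [hroot v hv]
      simpa using htt.le

/-- The linearised root sums at nearby points are close, since the roots of `x` are those of `m`
multiplied by a number close to `1`. -/
theorem norm_linRootSum_sub_le (hf : IsTestFunction f A M K η) (hA : 0 ≤ A) {b : ℕ} (hb : 2 ≤ b)
    {a : ℝ} (ha : 0 < a) {p m x : ℂ} (hm : m ≠ 0) (hx : 6 * ‖x - m‖ ≤ ‖m‖) {r : ℝ} (hr : 0 < r)
    (hrm : r ^ b = ‖m‖) :
    ‖linRootSum b f a p m - linRootSum b f a p x‖ ≤
      if a * ‖p‖ < 2 * b * A * r ^ (b - 1) then b * (η + 6 * K * A * (‖x - m‖ / ‖m‖)) else 0 := by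
  have hb0 : (0 : ℝ) < b := by exact_mod_cast (by omega : 0 < b)
  have hmn : 0 < ‖m‖ := norm_pos_iff.2 hm
  have hK := hf.K_nonneg
  have hη := hf.η_nonneg
  set t := (x - m) / m with ht
  have htn : ‖t‖ = ‖x - m‖ / ‖m‖ := norm_div _ _
  have ht6 : ‖t‖ ≤ 1 / 6 := by
    rw [htn, div_le_iff₀ hmn]
    linarith
  obtain ⟨τ, hτ, hτ0, h3⟩ := exists_root_one_add_inv_pow b hb t ht6
  have hxm : x = m * τ ^ b := by
    rw [hτ, ht]
    field_simp
    ring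
  unfold linRootSum
  rw [sum_nthRootsFinset_mul (by omega) hτ0 hxm, ← Finset.sum_sub_distrib]
  have hterm : ∀ u ∈ Polynomial.nthRootsFinset b m,
      ‖f (a * p / (b * u ^ (b - 1))) - f (a * p / (b * (u * τ) ^ (b - 1)))‖ ≤
        if a * ‖p‖ < 2 * b * A * r ^ (b - 1) then η + 6 * K * A * (‖x - m‖ / ‖m‖) else 0 := by
    intro u hu
    rw [Polynomial.mem_nthRootsFinset (by omega)] at hu
    have hur : ‖u‖ = r := by
      rw [← pow_left_inj₀ (norm_nonneg u) hr.le (by omega : b ≠ 0), hrm, ← hu, norm_pow]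
    set y := (a : ℂ) * p / (b * u ^ (b - 1)) with hy
    have hyn : ‖y‖ = a * ‖p‖ / (b * r ^ (b - 1)) := by rw [hy, norm_linearised_arg ha, hur]
    have hyy : (a : ℂ) * p / (b * (u * τ) ^ (b - 1)) = y * (τ ^ (b - 1))⁻¹ := by
      rw [hy, mul_pow, ← mul_assoc, div_mul_eq_div_div _ _ (τ ^ (b - 1)), div_eq_mul_inv _ (τ ^ _)]
    rw [hyy]
    split_ifs with hcond
    · refine (hf.norm_sub_le _ _).trans ?_
      rw [show y - y * (τ ^ (b - 1))⁻¹ = -(y * ((τ ^ (b - 1))⁻¹ - 1)) by ring, norm_neg, norm_mul]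
      have h4 : ‖y‖ ≤ 2 * A := by
        rw [hyn, div_le_iff₀ (by positivity)]
        linarith
      have h5 : ‖y‖ * ‖(τ ^ (b - 1))⁻¹ - 1‖ ≤ 2 * A * (3 * ‖t‖) := by gcongr
      rw [← htn]
      nlinarith
    · push Not at hcond
      have h4 : 2 * A ≤ ‖y‖ := by
        rw [hyn, le_div_iff₀ (by positivity)]
        linarith
      have h5 : 1 / 2 ≤ ‖(τ ^ (b - 1))⁻¹‖ := by
        have := norm_sub_norm_le (1 : ℂ) (1 - (τ ^ (b - 1))⁻¹)
        rw [norm_one, norm_sub_rev 1 (τ ^ (b - 1))⁻¹, sub_sub_cancel] at this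
        linarith
      rw [hf.eq_zero y (by linarith), hf.eq_zero, sub_zero, norm_zero]
      rw [norm_mul]
      nlinarith [norm_nonneg y]
  refine (norm_sum_le_of_le _ hterm).trans ?_
  rw [Finset.sum_const, nsmul_eq_mul]
  split_ifs
  · gcongr
    exact card_nthRootsFinset_le b m
  · simp

/-- The scale at which a pair with difference of modulus `q` can contribute: the condition bounds
`q` from above and the modulus `r ^ b` of the first point from below. The exponent `2` comes from
`b ≤ 2 (b - 1)`. -/
theorem pow_div_pow_le_of_lt {b : ℕ} (hb : 2 ≤ b) {ε ν r B q : ℝ} (hν : 0 < ν) (hr : 0 < r)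
    (hrν : r ≤ ν) (hε : 0 < ε) (hq : 0 < q) (h : ε * ν ^ (b - 1) * q < B * r ^ (b - 1)) :
    ε * q ≤ B ∧ ν ^ b / r ^ b ≤ (B / (ε * q)) ^ 2 := by
  have h1 : 1 ≤ ν / r := by rwa [one_le_div hr]
  have h2 : (ν / r) ^ (b - 1) < B / (ε * q) := by
    rw [div_pow, div_lt_div_iff₀ (by positivity) (by positivity)]
    linarith
  have h3 : 1 ≤ (ν / r) ^ (b - 1) := one_le_pow₀ h1
  constructor
  · have : 1 < B / (ε * q) := lt_of_le_of_lt h3 h2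
    rw [one_lt_div (by positivity)] at this
    exact this.le
  · rw [← div_pow]
    calc (ν / r) ^ b ≤ (ν / r) ^ ((b - 1) * 2) := pow_le_pow_right₀ h1 (by omega)
      _ = ((ν / r) ^ (b - 1)) ^ 2 := pow_mul _ _ _
      _ ≤ _ := by gcongr

end

/-! ### Tilings of the plane by unit cells -/

/-- `fl` assigns to every point of the plane a point of `S` at distance at most `D`, and its fibres
over the points of `S` are measurable of area `1`. -/
structure IsUnitTiling (S : Set ℂ) (D : ℝ) (fl : ℂ → ℂ) : Prop where
  mem : ∀ x, fl x ∈ S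
  norm_sub_le : ∀ x, ‖x - fl x‖ ≤ D
  measurableSet_fiber : ∀ m ∈ S, MeasurableSet (fl ⁻¹' {m})
  volume_fiber : ∀ m ∈ S, volume (fl ⁻¹' {m}) = 1

/-- The translates of a fundamental parallelogram tile the plane. -/
theorem exists_isUnitTiling_grid (L : Submodule ℤ ℂ) [DiscreteTopology L] [IsZLattice ℝ L]
    (hL : ZLattice.covolume L volume = 1) (z₀ : ℂ) :
    ∃ (D : ℝ) (fl : ℂ → ℂ), 1 ≤ D ∧ IsUnitTiling (grid L z₀) D fl := by
  have : Module.Finite ℤ L := ZLattice.module_finite ℝ L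
  have : Module.Free ℤ L := ZLattice.module_free ℝ L
  set B₀ := Module.Free.chooseBasis ℤ L
  set B := B₀.ofZLatticeBasis ℝ L
  have hspan : Submodule.span ℤ (Set.range B) = L := B₀.ofZLatticeBasis_span ℝ
  have hvol : volume (ZSpan.fundamentalDomain B) = 1 := by
    have h := ZLattice.covolume_eq_measure_fundamentalDomain L volume
      (ZLattice.isAddFundamentalDomain B₀ volume)
    rw [hL, measureReal_def, eq_comm, ENNReal.toReal_eq_one_iff] at h
    exact h
  have hmem (x : ℂ) : ((ZSpan.floor B x : Submodule.span ℤ (Set.range B)) : ℂ) ∈ L :=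
    hspan.le (ZSpan.floor B x).2
  have hfiber (p : ℂ) (hp : p ∈ L) :
      (fun x => z₀ + (ZSpan.floor B (x - z₀) : ℂ)) ⁻¹' {z₀ + p} =
        (fun x => x - (z₀ + p)) ⁻¹' ZSpan.fundamentalDomain B := by
    ext x
    simp only [Set.mem_preimage, Set.mem_singleton_iff, add_right_inj]
    rw [← ZSpan.fract_eq_self]
    have h1 : x - (z₀ + p) = (x - z₀) + -p := by ring
    rw [h1, ZSpan.fract_add_ZSpan B _ (by rw [hspan]; exact neg_mem hp), ZSpan.fract_apply]
    constructor
    · intro h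
      rw [h]
      ring
    · intro h
      linear_combination -h
  refine ⟨max 1 (∑ i, ‖B i‖), fun x => z₀ + (ZSpan.floor B (x - z₀) : ℂ), le_max_left _ _, ?_⟩
  refine ⟨fun x => ⟨_, hmem _, rfl⟩, fun x => ?_, ?_, ?_⟩
  · refine le_trans ?_ (le_max_right _ _)
    have := ZSpan.norm_fract_le B (x - z₀)
    rw [ZSpan.fract_apply] at this
    rwa [← sub_sub]
  · rintro _ ⟨p, hp, rfl⟩
    rw [hfiber p hp]
    exact (measurable_id.sub_const _) (ZSpan.fundamentalDomain_measurableSet B)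
  · rintro _ ⟨p, hp, rfl⟩
    rw [hfiber p hp]
    simp_rw [sub_eq_add_neg]
    rw [measure_preimage_add_right, hvol]

theorem grid_zero (L : Submodule ℤ ℂ) : grid L 0 = (L : Set ℂ) := by
  ext x
  simp [grid]

namespace IsUnitTiling

variable {S : Set ℂ} {D : ℝ} {fl : ℂ → ℂ} {E : Type*} [NormedAddCommGroup E]

theorem D_nonneg (h : IsUnitTiling S D fl) : 0 ≤ D := (norm_nonneg _).trans (h.norm_sub_le 0)

theorem norm_le (h : IsUnitTiling S D fl) (x : ℂ) : ‖x‖ ≤ ‖fl x‖ + D := by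
  have := norm_sub_norm_le x (fl x)
  linarith [h.norm_sub_le x]

theorem norm_fl_le (h : IsUnitTiling S D fl) (x : ℂ) : ‖fl x‖ ≤ ‖x‖ + D := by
  have := norm_sub_norm_le (fl x) x
  rw [norm_sub_rev] at this
  linarith [h.norm_sub_le x]

theorem indicator_eq_sum (F : Finset ℂ) (g : ℂ → E) :
    (fl ⁻¹' (F : Set ℂ)).indicator (fun x => g (fl x)) =
      fun x => ∑ m ∈ F, (fl ⁻¹' {m}).indicator (fun _ => g m) x := by
  classical
  ext x
  by_cases hx : fl x ∈ F
  · rw [Set.indicator_of_mem (by simpa using hx), Finset.sum_eq_single (fl x)]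
    · simp
    · intro m _ hne
      exact Set.indicator_of_notMem (fun h => hne h.symm) _
    · exact fun h => absurd hx h
  · rw [Set.indicator_of_notMem (by simpa using hx), Finset.sum_eq_zero]
    intro m hm
    refine Set.indicator_of_notMem (fun h => hx ?_) _
    rw [Set.mem_preimage, Set.mem_singleton_iff] at h
    rwa [h]

theorem integrable_indicator (h : IsUnitTiling S D fl) {F : Finset ℂ} (hF : (F : Set ℂ) ⊆ S)
    (g : ℂ → E) : Integrable ((fl ⁻¹' (F : Set ℂ)).indicator fun x => g (fl x)) := by
  rw [indicator_eq_sum]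
  refine integrable_finsetSum _ fun m hm => ?_
  rw [integrable_indicator_iff (h.measurableSet_fiber m (hF hm))]
  refine integrableOn_const (by rw [h.volume_fiber m (hF hm)]; simp)

/-- A sum over finitely many points of `S` is an integral over the plane. -/
theorem integral_indicator [NormedSpace ℝ E] [CompleteSpace E] (h : IsUnitTiling S D fl)
    {F : Finset ℂ} (hF : (F : Set ℂ) ⊆ S) (g : ℂ → E) :
    ∫ x, (fl ⁻¹' (F : Set ℂ)).indicator (fun x => g (fl x)) x = ∑ m ∈ F, g m := by
  rw [indicator_eq_sum, integral_finsetSum]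
  · refine Finset.sum_congr rfl fun m hm => ?_
    rw [MeasureTheory.integral_indicator (h.measurableSet_fiber m (hF hm)), setIntegral_const,
      measureReal_def, h.volume_fiber m (hF hm)]
    simp
  · intro m hm
    rw [integrable_indicator_iff (h.measurableSet_fiber m (hF hm))]
    exact integrableOn_const (by rw [h.volume_fiber m (hF hm)]; simp)

/-- Sums over `S` are bounded by the integral of a function which dominates the summand on the
cells. -/
theorem sum_le_integral (h : IsUnitTiling S D fl) {F : Finset ℂ} (hF : (F : Set ℂ) ⊆ S)
    {g G : ℂ → ℝ} (hG : Integrable G) (hG0 : ∀ x, 0 ≤ G x)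
    (hle : ∀ᵐ x, fl x ∈ F → g (fl x) ≤ G x) : ∑ m ∈ F, g m ≤ ∫ x, G x := by
  rw [← h.integral_indicator hF]
  refine integral_mono_ae (h.integrable_indicator hF g) hG ?_
  filter_upwards [hle] with x hx
  by_cases hxF : fl x ∈ F
  · rw [Set.indicator_of_mem (by simpa using hxF)]
    exact hx hxF
  · rw [Set.indicator_of_notMem (by simpa using hxF)]
    exact hG0 x

theorem card_le (h : IsUnitTiling S D fl) {F : Finset ℂ} (hF : (F : Set ℂ) ⊆ S) {T : ℝ}
    (hT : ∀ m ∈ F, ‖m‖ ≤ T) : (F.card : ℝ) ≤ Real.pi * (T + D) ^ 2 := by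
  rcases F.eq_empty_or_nonempty with rfl | ⟨m₀, hm₀⟩
  · simp only [Finset.card_empty, Nat.cast_zero]
    have := Real.pi_pos
    positivity
  have hT0 : 0 ≤ T + D := add_nonneg ((norm_nonneg _).trans (hT m₀ hm₀)) h.D_nonneg
  have := h.sum_le_integral (F := F) hF (g := fun _ => 1)
    (G := (Metric.closedBall (0 : ℂ) (T + D)).indicator fun _ => 1) ?_ ?_ ?_
  · rw [MeasureTheory.integral_indicator measurableSet_closedBall] at this
    simpa [measureReal_def, Complex.volume_closedBall, ENNReal.toReal_ofReal hT0, mul_comm]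
      using this
  · rw [integrable_indicator_iff measurableSet_closedBall]
    exact integrableOn_const (by rw [Complex.volume_closedBall]; finiteness)
  · intro x
    exact Set.indicator_nonneg (fun _ _ => zero_le_one) x
  · refine Eventually.of_forall fun x hx => ?_
    rw [Set.indicator_of_mem]
    rw [mem_closedBall_zero_iff]
    linarith [h.norm_le x, hT _ hx]

theorem finite_inter_closedBall (h : IsUnitTiling S D fl) (T : ℝ) :
    (S ∩ Metric.closedBall 0 T).Finite := by
  by_contra hinf
  obtain ⟨F, hF, hcard⟩ := Set.Infinite.exists_subset_card_eq hinf
    (⌊Real.pi * (T + D) ^ 2⌋₊ + 1)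
  have h1 := h.card_le (F := F) (fun m hm => (hF hm).1) (T := T)
    (fun m hm => by simpa using (hF hm).2)
  rw [hcard] at h1
  push_cast at h1
  linarith [Nat.lt_floor_add_one (Real.pi * (T + D) ^ 2)]

theorem exists_pos_le_norm (h : IsUnitTiling S D fl) :
    ∃ σ : ℝ, 0 < σ ∧ ∀ m ∈ S, m ≠ 0 → σ ≤ ‖m‖ := by
  have hfin := (h.finite_inter_closedBall 1).sdiff (t := {0})
  have hmem : ((S ∩ Metric.closedBall 0 1) \ {0})ᶜ ∈ 𝓝 (0 : ℂ) :=
    hfin.isClosed.isOpen_compl.mem_nhds (by simp)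
  obtain ⟨σ, hσ, hball⟩ := Metric.mem_nhds_iff.1 hmem
  refine ⟨min σ 1, by positivity, fun m hm h0 => ?_⟩
  by_contra! hlt
  refine hball (show m ∈ Metric.ball 0 σ by simpa using hlt.trans_le (min_le_left _ _)) ?_
  refine ⟨⟨hm, ?_⟩, h0⟩
  simpa using (hlt.trans_le (min_le_right _ _)).le

end IsUnitTiling

/-- `1 / ‖x‖` is integrable on disks, and its integral is proportional to the radius. -/
theorem integral_indicator_inv_norm {R : ℝ} (hR : 0 ≤ R) :
    Integrable (fun x : ℂ => (Set.Iic R).indicator (fun y => y⁻¹) ‖x‖) ∧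
      ∫ x : ℂ, (Set.Iic R).indicator (fun y => y⁻¹) ‖x‖ = 2 * Real.pi * R := by
  have heq : Set.EqOn (fun y : ℝ => y ^ (Module.finrank ℝ ℂ - 1) •
      (Set.Iic R).indicator (fun y => y⁻¹) y) ((Set.Iic R).indicator fun _ => 1) (Set.Ioi 0) := by
    intro y hy
    have hy' : y ≠ 0 := ne_of_gt hy
    by_cases hyR : y ∈ Set.Iic R
    · simp [hyR, hy']
    · simp [hyR]
  have hinter : Set.Ioi 0 ∩ Set.Iic R = Set.Ioc 0 R := rfl
  constructor
  · rw [integrable_fun_norm_addHaar volume (f := (Set.Iic R).indicator fun y => y⁻¹),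
      integrableOn_congr_fun heq measurableSet_Ioi]
    unfold IntegrableOn
    rw [integrable_indicator_iff measurableSet_Iic, IntegrableOn,
      Measure.restrict_restrict measurableSet_Iic, Set.inter_comm, hinter]
    exact integrableOn_const (by simp)
  · rw [integral_fun_norm_addHaar volume ((Set.Iic R).indicator fun y => y⁻¹),
      setIntegral_congr_fun measurableSet_Ioi heq, setIntegral_indicator measurableSet_Iic, hinter]
    simp [measureReal_def, Complex.volume_ball, hR]
    ring

theorem IsUnitTiling.sum_inv_norm_le {S : Set ℂ} {D : ℝ} {fl : ℂ → ℂ} (h : IsUnitTiling S D fl)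
    {F : Finset ℂ} (hF : (F : Set ℂ) ⊆ S) {T σ : ℝ} (hσ : 0 < σ) (hσF : ∀ m ∈ F, σ ≤ ‖m‖)
    (hT0 : 0 ≤ T) (hT : ∀ m ∈ F, ‖m‖ ≤ T) :
    ∑ m ∈ F, ‖m‖⁻¹ ≤ (1 + D / σ) * (2 * Real.pi * (T + D)) := by
  have hD := h.D_nonneg
  obtain ⟨h1, h2⟩ := integral_indicator_inv_norm (add_nonneg hT0 hD)
  rw [← h2, ← integral_const_mul]
  refine h.sum_le_integral hF (h1.const_mul _) (fun x => ?_) ?_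
  · refine mul_nonneg (by positivity) ?_
    rw [Set.indicator_apply]
    split_ifs <;> positivity
  · have h0 : ∀ᵐ x : ℂ, x ≠ 0 := by simp [ae_iff]
    filter_upwards [h0] with x hx0 hx
    have hσx := hσF _ hx
    have hx1 : 0 < ‖x‖ := norm_pos_iff.2 hx0
    have hm : 0 < ‖fl x‖ := hσ.trans_le hσx
    rw [Set.indicator_of_mem (by rw [Set.mem_Iic]; linarith [h.norm_le x, hT _ hx]),
      inv_eq_one_div, ← div_eq_mul_inv, div_le_div_iff₀ hm hx1, one_mul]
    have : D ≤ D / σ * ‖fl x‖ := by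
      rw [div_mul_eq_mul_div, le_div_iff₀ hσ]
      gcongr
    linarith [h.norm_le x]

/-! ### The systole -/

theorem exists_mem_ne_zero {L : Submodule ℤ ℂ} {D : ℝ} {fl : ℂ → ℂ}
    (h : IsUnitTiling (L : Set ℂ) D fl) : ∃ p ∈ L, p ≠ 0 := by
  refine ⟨fl ((D + 1 : ℝ) : ℂ), h.mem _, fun h0 => ?_⟩
  have := h.norm_le ((D + 1 : ℝ) : ℂ)
  rw [h0, norm_zero, Complex.norm_real, Real.norm_eq_abs] at this
  linarith [le_abs_self (D + 1)]

theorem systole_le_norm (L : Submodule ℤ ℂ) {p : ℂ} (hp : p ∈ L) (h0 : p ≠ 0) :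
    systole L ≤ ‖p‖ := by
  refine csInf_le ⟨0, ?_⟩ ⟨p, hp, h0, rfl⟩
  rintro _ ⟨q, -, -, rfl⟩
  exact norm_nonneg q

theorem systole_pos {L : Submodule ℤ ℂ} {D : ℝ} {fl : ℂ → ℂ}
    (h : IsUnitTiling (L : Set ℂ) D fl) : 0 < systole L := by
  obtain ⟨σ, hσ, hle⟩ := h.exists_pos_le_norm
  obtain ⟨p, hp, h0⟩ := exists_mem_ne_zero h
  refine hσ.trans_le (le_csInf ⟨‖p‖, p, hp, h0, rfl⟩ ?_)
  rintro _ ⟨q, hq, hq0, rfl⟩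
  exact hle q hq hq0

section

/-! ### From lattice sums to integrals -/

theorem linRootSum_eq_sum_roots_of_unity {b : ℕ} (hb : 0 < b) (f : ℂ → ℂ) (a : ℝ) (p : ℂ) {x : ℂ}
    (hx : x ≠ 0) :
    linRootSum b f a p x = ∑ ω ∈ Polynomial.nthRootsFinset b (1 : ℂ),
      f (a * p / (b * (ω * x ^ (b : ℂ)⁻¹) ^ (b - 1))) := by
  refine sum_nthRootsFinset_mul hb (x := 1) (τ := x ^ (b : ℂ)⁻¹) ?_ ?_ _
  · rw [Ne, Complex.cpow_eq_zero_iff]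
    exact fun h => hx h.1
  · rw [one_mul, Complex.cpow_nat_inv_pow x hb.ne']

theorem ae_ne_zero : ∀ᵐ x : ℂ, x ≠ 0 := by simp [ae_iff]

theorem aestronglyMeasurable_linRootSum {b : ℕ} (hb : 0 < b) {f : ℂ → ℂ} (hf : Continuous f)
    (a : ℝ) (p : ℂ) : AEStronglyMeasurable (linRootSum b f a p) := by
  have hmeas : Measurable fun x : ℂ => ∑ ω ∈ Polynomial.nthRootsFinset b (1 : ℂ),
      f (a * p / (b * (ω * x ^ (b : ℂ)⁻¹) ^ (b - 1))) := by
    have := hf.measurable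
    fun_prop
  refine hmeas.aestronglyMeasurable.congr ?_
  filter_upwards [ae_ne_zero] with x hx
  exact (linRootSum_eq_sum_roots_of_unity hb f a p hx).symm

variable {f : ℂ → ℂ} {A M K η : ℝ}

theorem integrableOn_linRootSum (hf : IsTestFunction f A M K η) {b : ℕ} (hb : 0 < b) (a : ℝ) (p : ℂ)
    (R : ℝ) : IntegrableOn (linRootSum b f a p) (Metric.closedBall 0 R) := by
  refine Measure.integrableOn_of_bounded (M := b * M) ?_
    (aestronglyMeasurable_linRootSum hb hf.continuous a p)
    (Eventually.of_forall fun x => norm_linRootSum_le hf b a p x)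
  rw [Complex.volume_closedBall]
  finiteness

theorem linRootSum_eq_zero_of_norm_le (hf : IsTestFunction f A M K η) (hA : 0 ≤ A) {b : ℕ}
    (hb : 2 ≤ b) {a : ℝ} (ha : 0 < a) {p x : ℂ} (hx : x ≠ 0) {R : ℝ} (hR : 1 ≤ R) (hxR : ‖x‖ ≤ R)
    (h : b * A * R ≤ a * ‖p‖) : linRootSum b f a p x = 0 := by
  refine linRootSum_eq_zero hf hb ha hx fun r hr hrb => le_trans ?_ h
  gcongr
  rcases le_total r 1 with h1 | h1
  · exact (pow_le_one₀ hr.le h1).trans hR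
  · exact (pow_le_pow_right₀ h1 (Nat.sub_le _ _)).trans (hrb.le.trans hxR)

/-- The area of an annulus is at most a multiple of its outer radius times its thickness. -/
theorem volume_real_annulus_le {R s : ℝ} (hR : 0 ≤ R) (hs : 0 ≤ s) :
    volume.real (Metric.closedBall (0 : ℂ) R \ Metric.ball 0 (R - s)) ≤ 2 * Real.pi * R * s := by
  have hπ := Real.pi_pos
  have hball : Metric.ball (0 : ℂ) (R - s) ⊆ Metric.closedBall 0 R :=
    (Metric.ball_subset_ball (by linarith)).trans Metric.ball_subset_closedBall
  rw [measureReal_sdiff hball measurableSet_ball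
    (by rw [Complex.volume_closedBall]; finiteness)]
  have h1 : volume.real (Metric.closedBall (0 : ℂ) R) = Real.pi * R ^ 2 := by
    simp [measureReal_def, Complex.volume_closedBall, hR, mul_comm]
  rw [h1]
  rcases le_total 0 (R - s) with h | h
  · have h2 : volume.real (Metric.ball (0 : ℂ) (R - s)) = Real.pi * (R - s) ^ 2 := by
      simp [measureReal_def, Complex.volume_ball, h, mul_comm]
    rw [h2]
    nlinarith [mul_nonneg hπ.le (sq_nonneg s)]
  · have h2 : 0 ≤ volume.real (Metric.ball (0 : ℂ) (R - s)) := measureReal_nonneg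
    nlinarith [mul_nonneg (mul_nonneg hπ.le hR) (sub_nonneg.2 (sub_nonpos.1 h)),
      mul_nonneg (mul_nonneg hπ.le hR) hs]

/-- The error made on each pair of points with difference `p`, where points have modulus at most
`N`. The parameter `c` absorbs the ratio of the cell diameter to the systole. -/
noncomputable def pairError (b : ℕ) (c A K η N ε : ℝ) (p : ℂ) : ℝ :=
  η + 24 * b ^ 3 * c * (K * A ^ 3 / (N * ε ^ 2)) * ‖p‖⁻¹

theorem pairError_nonneg {b : ℕ} {c N ε : ℝ} (hc : 0 ≤ c) (hA : 0 ≤ A) (hK : 0 ≤ K) (hη : 0 ≤ η)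
    (hN : 0 ≤ N) (p : ℂ) : 0 ≤ pairError b c A K η N ε p := by
  unfold pairError
  positivity

/-- A first order error `c' * K * A * (q / ‖m‖)` is bounded by `pairError`, at all scales where the
pair contributes. -/
theorem le_pairError {b : ℕ} (hb : 2 ≤ b) {c c' N ε ν r q : ℝ} {p : ℂ} (hA : 0 ≤ A) (hK : 0 ≤ K)
    (hν : 0 < ν) (hN : N = ν ^ b) (hr : 0 < r) (hrν : r ≤ ν) (hε : 0 < ε) (hp : 0 < ‖p‖)
    (hc' : 0 ≤ c') (hq : c' * q ≤ 6 * b * c * ‖p‖)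
    (h : ε * ν ^ (b - 1) * ‖p‖ < 2 * b * A * r ^ (b - 1)) (hq0 : 0 ≤ q) :
    ε * ‖p‖ ≤ 2 * b * A ∧ η + c' * K * A * (q / r ^ b) ≤ pairError b c A K η N ε p := by
  obtain ⟨h1, h2⟩ := pow_div_pow_le_of_lt hb hν hr hrν hε hp h
  refine ⟨h1, ?_⟩
  unfold pairError
  rw [← hN] at h2
  have hN0 : 0 < N := by rw [hN]; positivity
  have h3 : (r ^ b)⁻¹ ≤ (2 * b * A / (ε * ‖p‖)) ^ 2 / N := by
    rw [le_div_iff₀ hN0, mul_comm]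
    exact h2
  have h4 : c' * K * A * (q / r ^ b) = (c' * q) * (K * A) * (r ^ b)⁻¹ := by
    rw [div_eq_mul_inv]
    ring
  have h5 : (c' * q) * (K * A) * (r ^ b)⁻¹ ≤
      (6 * b * c * ‖p‖) * (K * A) * ((2 * b * A / (ε * ‖p‖)) ^ 2 / N) := by
    have h0 : 0 ≤ 6 * b * c * ‖p‖ := le_trans (by positivity) hq
    exact mul_le_mul (mul_le_mul_of_nonneg_right hq (by positivity)) h3 (by positivity)
      (by positivity)
  rw [h4]
  refine (add_le_add_iff_left _).2 (h5.trans (le_of_eq ?_))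
  field_simp
  ring

/-- The sum over the points `m` of `S` for which `m` and `m + p` have modulus at most `N` is
replaced by the integral over the disk of radius `N`. The first term of the bound is the variation
of the integrand on the cells, the second comes from the cells close to the boundary. -/
theorem norm_sum_linRootSum_sub_integral_le (hf : IsTestFunction f A M K η) (hA : 1 ≤ A) {b : ℕ}
    (hb : 2 ≤ b) {S : Set ℂ} {D : ℝ} {fl : ℂ → ℂ} (hS : IsUnitTiling S D fl) (hD : 1 ≤ D)
    {ε ν N σ : ℝ} (hν : 0 < ν) (hN : N = ν ^ b) (hε : 0 < ε) (hσ : 0 < σ) (hDN : D ≤ N)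
    (hlarge : 7 * b * (1 + D / σ) * A ≤ ε * ν ^ (b - 1)) {p : ℂ} (hp : σ ≤ ‖p‖) {F : Finset ℂ}
    (hF : ∀ m, m ∈ F ↔ m ∈ S ∧ m ≠ 0 ∧ m + p ≠ 0 ∧ ‖m‖ ≤ N ∧ ‖m + p‖ ≤ N) :
    ‖∑ m ∈ F, linRootSum b f (ε * ν ^ (b - 1)) p m -
        ∫ x in Metric.closedBall 0 N, linRootSum b f (ε * ν ^ (b - 1)) p x‖ ≤
      if ε * ‖p‖ ≤ 2 * b * A then
        b * pairError b (1 + D / σ) A K η N ε p * (4 * Real.pi * N ^ 2) +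
          8 * b * Real.pi * (1 + 2 * D / σ) * M * N * ‖p‖
      else 0 := by
  classical
  set a := ε * ν ^ (b - 1) with ha
  have ha0 : 0 < a := by positivity
  have hA0 : 0 ≤ A := by linarith
  have hb1 : (1 : ℝ) ≤ b := by exact_mod_cast (by omega : 1 ≤ b)
  have hK := hf.K_nonneg
  have hη := hf.η_nonneg
  have hM := hf.M_nonneg
  have hN0 : 0 < N := by rw [hN]; positivity
  have hp0 : 0 < ‖p‖ := hσ.trans_le hp
  have hFS : (F : Set ℂ) ⊆ S := fun m hm => ((hF m).1 hm).1
  have hDp : D ≤ D / σ * ‖p‖ := by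
    rw [div_mul_eq_mul_div, le_div_iff₀ hσ]
    gcongr
  have he0 := pairError_nonneg (b := b) (c := 1 + D / σ) (ε := ε) (by positivity) hA0 hK hη hN0.le p
  set e := pairError b (1 + D / σ) A K η N ε p with he
  set G := linRootSum b f a p with hG
  -- Points close to the origin do not contribute, because `a` is large.
  have hsmall : ∀ x : ℂ, x ≠ 0 → (‖x‖ ≤ D + ‖p‖ ∨ ‖x‖ ≤ 7 * D) → G x = 0 := by
    intro x hx hor
    have h7 : 7 * b * (1 + D / σ) * A * ‖p‖ ≤ a * ‖p‖ := by gcongr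
    have hbA : 0 ≤ (b : ℝ) * A := by positivity
    rcases hor with h | h
    · refine linRootSum_eq_zero_of_norm_le hf hA0 hb ha0 hx (by linarith) h (le_trans ?_ h7)
      have : (b : ℝ) * A * (D + ‖p‖) ≤ b * A * (7 * (1 + D / σ) * ‖p‖) :=
        mul_le_mul_of_nonneg_left (by nlinarith) hbA
      linarith
    · refine linRootSum_eq_zero_of_norm_le hf hA0 hb ha0 hx (by linarith) h (le_trans ?_ h7)
      have : (b : ℝ) * A * (7 * D) ≤ b * A * (7 * (1 + D / σ) * ‖p‖) :=
        mul_le_mul_of_nonneg_left (by nlinarith) hbA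
      linarith
  have hfar : 2 * b * A < ε * ‖p‖ → ∀ x : ℂ, x ≠ 0 → ‖x‖ ≤ N → G x = 0 := by
    intro hlt x hx hxN
    refine linRootSum_eq_zero hf hb ha0 hx fun r hr hrb => ?_
    have hrν : r ≤ ν := by
      rw [← pow_le_pow_iff_left₀ hr.le hν.le (by omega : b ≠ 0), hrb, ← hN]
      exact hxN
    have hbA : 0 ≤ (b : ℝ) * A := by positivity
    calc b * A * r ^ (b - 1) ≤ b * A * ν ^ (b - 1) := by gcongr
      _ ≤ ε * ‖p‖ * ν ^ (b - 1) := mul_le_mul_of_nonneg_right (by linarith) (by positivity)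
      _ = a * ‖p‖ := by rw [ha]; ring
  set ann : Set ℂ := Metric.closedBall 0 (N + D) \ Metric.ball 0 (N + D - (2 * D + ‖p‖)) with hann
  set bound : ℂ → ℝ := fun x => if ε * ‖p‖ ≤ 2 * b * A then
    (Metric.closedBall (0 : ℂ) (N + D)).indicator (fun _ => b * e) x +
      ann.indicator (fun _ => 2 * b * M) x else 0 with hbound
  have hboundnn : ∀ x, 0 ≤ bound x := by
    intro x
    simp only [hbound]
    split_ifs
    · exact add_nonneg (Set.indicator_nonneg (fun _ _ => by positivity) _)
        (Set.indicator_nonneg (fun _ _ => by positivity) _)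
    · exact le_rfl
  -- The cases are: `p` too large to contribute, `x` outside the disk of radius `N + D`, `x` in the
  -- annulus, and `x` inside, where the cell is dropped only if it is close to `0` or to `-p`.
  have hpoint : ∀ᵐ x : ℂ, ‖(fl ⁻¹' (F : Set ℂ)).indicator (fun x => G (fl x)) x -
      (Metric.closedBall 0 N).indicator G x‖ ≤ bound x := by
    filter_upwards [ae_ne_zero] with x hx
    have hflx := hS.norm_sub_le x
    have hle1 := hS.norm_le x
    have hle2 := hS.norm_fl_le x
    by_cases hcut : ε * ‖p‖ ≤ 2 * b * A
    swap
    · push Not at hcut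
      have h1 : (fl ⁻¹' (F : Set ℂ)).indicator (fun x => G (fl x)) x = 0 := by
        refine Set.indicator_apply_eq_zero.2 fun hmem => ?_
        obtain ⟨-, h0, -, hle, -⟩ := (hF _).1 hmem
        exact hfar hcut _ h0 hle
      have h2 : (Metric.closedBall 0 N).indicator G x = 0 :=
        Set.indicator_apply_eq_zero.2 fun hmem => hfar hcut x hx (by simpa using hmem)
      rw [h1, h2, sub_zero, norm_zero]
      exact hboundnn x
    rcases lt_or_ge (N + D) ‖x‖ with hout | hin
    · rw [Set.indicator_of_notMem, Set.indicator_of_notMem, sub_zero, norm_zero]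
      · exact hboundnn x
      · rw [mem_closedBall_zero_iff]
        linarith
      · intro hmem
        obtain ⟨-, -, -, hle, -⟩ := (hF _).1 hmem
        linarith
    have hxin : x ∈ Metric.closedBall (0 : ℂ) (N + D) := by simpa using hin
    have hbx : bound x = b * e + ann.indicator (fun _ => 2 * b * M) x := by
      simp only [hbound, if_pos hcut, Set.indicator_of_mem hxin]
    have hannnn : 0 ≤ ann.indicator (fun _ => 2 * b * M) x :=
      Set.indicator_nonneg (fun _ _ => by positivity) _
    have hbe : 0 ≤ b * e := by positivity
    rcases lt_or_ge ‖x‖ (N + D - (2 * D + ‖p‖)) with hinner | hbdry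
    swap
    · have hxann : x ∈ ann := ⟨hxin, by simpa using hbdry⟩
      rw [hbx, Set.indicator_of_mem hxann]
      have hGle := norm_linRootSum_le hf b a p
      have h1 : ‖(fl ⁻¹' (F : Set ℂ)).indicator (fun x => G (fl x)) x‖ ≤ b * M :=
        (norm_indicator_le_norm_self _ _).trans (hGle _)
      have h2 : ‖(Metric.closedBall 0 N).indicator G x‖ ≤ b * M :=
        (norm_indicator_le_norm_self _ _).trans (hGle _)
      refine (norm_sub_le _ _).trans ?_
      linarith
    have hxN : x ∈ Metric.closedBall (0 : ℂ) N := by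
      rw [mem_closedBall_zero_iff]
      linarith
    rw [Set.indicator_of_mem hxN]
    by_cases hmem : fl x ∈ F
    swap
    · rw [Set.indicator_of_notMem (by simpa using hmem), hsmall x hx, sub_zero, norm_zero]
      · exact hboundnn x
      · left
        have hor : ‖fl x‖ ≤ ‖p‖ := by
          by_contra! hlt
          refine hmem ((hF _).2 ⟨hS.mem x, ?_, ?_, by linarith, ?_⟩)
          · rw [← norm_pos_iff]
            linarith
          · intro h0
            rw [eq_neg_of_add_eq_zero_left h0, norm_neg] at hlt
            exact lt_irrefl _ hlt
          · refine (norm_add_le _ _).trans ?_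
            linarith
        linarith
    rw [Set.indicator_of_mem (by simpa using hmem)]
    obtain ⟨-, hm0, -, hmN, -⟩ := (hF _).1 hmem
    rcases lt_or_ge ‖fl x‖ (6 * D) with hlt | hge
    · rw [hsmall x hx (Or.inr (by linarith)), hsmall _ hm0 (Or.inr (by linarith)), sub_zero,
        norm_zero]
      exact hboundnn x
    have hr : 0 < ‖fl x‖ ^ (b : ℝ)⁻¹ := Real.rpow_pos_of_pos (norm_pos_iff.2 hm0) _
    have hrb : (‖fl x‖ ^ (b : ℝ)⁻¹) ^ b = ‖fl x‖ :=
      Real.rpow_inv_natCast_pow (norm_nonneg _) (by omega)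
    set r := ‖fl x‖ ^ (b : ℝ)⁻¹
    refine (norm_linRootSum_sub_le hf hA0 hb ha0 hm0 (by linarith) hr hrb).trans ?_
    split_ifs with hcond
    · have hrν : r ≤ ν := by
        rw [← pow_le_pow_iff_left₀ hr.le hν.le (by omega : b ≠ 0), hrb, ← hN]
        exact hmN
      have hq : 6 * ‖x - fl x‖ ≤ 6 * b * (1 + D / σ) * ‖p‖ := by
        have h1 : ‖x - fl x‖ ≤ 1 * ((1 + D / σ) * ‖p‖) := by linarith
        have h2 : 1 * ((1 + D / σ) * ‖p‖) ≤ b * ((1 + D / σ) * ‖p‖) := by gcongr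
        linarith
      obtain ⟨-, h2⟩ := le_pairError (η := η) hb hA0 hK hν hN hr hrν hε hp0 (by norm_num) hq hcond
        (norm_nonneg _)
      rw [hrb] at h2
      rw [hbx]
      have : b * (η + 6 * K * A * (‖x - fl x‖ / ‖fl x‖)) ≤ b * e := by gcongr
      linarith
    · exact hboundnn x
  have hint1 := hS.integrable_indicator hFS G
  have hint2 : Integrable ((Metric.closedBall 0 N).indicator G) := by
    rw [integrable_indicator_iff measurableSet_closedBall]
    exact integrableOn_linRootSum hf (by omega) a p N
  have hannm : MeasurableSet ann := MeasurableSet.diff measurableSet_closedBall measurableSet_ball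
  have hfinb : volume (Metric.closedBall (0 : ℂ) (N + D)) ≠ ⊤ := by
    rw [Complex.volume_closedBall]
    finiteness
  have hi1 : Integrable ((Metric.closedBall (0 : ℂ) (N + D)).indicator fun _ => b * e) := by
    rw [integrable_indicator_iff measurableSet_closedBall]
    exact integrableOn_const hfinb
  have hi2 : Integrable (ann.indicator fun _ => 2 * b * M) := by
    rw [integrable_indicator_iff hannm]
    exact integrableOn_const (ne_top_of_le_ne_top hfinb (measure_mono Set.sdiff_subset))
  rw [← hS.integral_indicator hFS, ← MeasureTheory.integral_indicator measurableSet_closedBall,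
    ← integral_sub hint1 hint2]
  have hboundint : Integrable bound := by
    simp only [hbound]
    split_ifs
    · exact hi1.add hi2
    · exact integrable_zero _ _ _
  refine (norm_integral_le_of_norm_le hboundint hpoint).trans ?_
  simp only [hbound]
  split_ifs with hcut
  swap
  · simp
  rw [integral_add hi1 hi2, MeasureTheory.integral_indicator measurableSet_closedBall,
    MeasureTheory.integral_indicator hannm, setIntegral_const, setIntegral_const, smul_eq_mul,
    smul_eq_mul]
  have hπ := Real.pi_pos
  have hv1 : volume.real (Metric.closedBall (0 : ℂ) (N + D)) ≤ 4 * Real.pi * N ^ 2 := by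
    have : volume.real (Metric.closedBall (0 : ℂ) (N + D)) = Real.pi * (N + D) ^ 2 := by
      simp [measureReal_def, Complex.volume_closedBall, (by linarith : 0 ≤ N + D), mul_comm]
    rw [this]
    have : (N + D) ^ 2 ≤ (2 * N) ^ 2 := by gcongr; linarith
    nlinarith
  have hv2 : volume.real ann ≤ 4 * Real.pi * N * ((1 + 2 * D / σ) * ‖p‖) := by
    refine (volume_real_annulus_le (by linarith) (by linarith)).trans ?_
    have h1 : 2 * D + ‖p‖ ≤ (1 + 2 * D / σ) * ‖p‖ := by
      rw [show (1 + 2 * D / σ) * ‖p‖ = 2 * (D / σ * ‖p‖) + ‖p‖ by ring]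
      linarith
    calc 2 * Real.pi * (N + D) * (2 * D + ‖p‖)
        ≤ 2 * Real.pi * (N + N) * ((1 + 2 * D / σ) * ‖p‖) := by gcongr
      _ = _ := by ring
  have hbe : 0 ≤ b * e := by positivity
  have h1 := mul_le_mul_of_nonneg_right hv1 hbe
  have h2 := mul_le_mul_of_nonneg_right hv2 (by positivity : 0 ≤ 2 * b * M)
  linarith

end

section

/-! ### The limit density of a single lattice difference, in polar coordinates -/

theorem integral_eq_integral_polar {h : ℂ → ℂ} (hm : Measurable h) (hi : Integrable h) :
    ∫ z, h z = ∫ r in Set.Ioi (0 : ℝ), (r : ℂ) *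
      ∫ θ in -Real.pi..Real.pi, h (r * Complex.exp (θ * Complex.I)) := by
  have hint : IntegrableOn (fun p : ℝ × ℝ => p.1 • h (Complex.polarCoord.symm p))
      polarCoord.target := by
    have hcont : Measurable fun p : ℝ × ℝ => Complex.polarCoord.symm p := by
      simp only [Complex.polarCoord_symm_apply]
      fun_prop
    refine ⟨(measurable_fst.smul (hm.comp hcont)).aestronglyMeasurable, ?_⟩
    have hlt := hi.2
    rw [HasFiniteIntegral, ← Complex.lintegral_comp_polarCoord_symm] at hlt
    rw [HasFiniteIntegral]
    refine lt_of_le_of_lt (le_of_eq (setLIntegral_congr_fun polarCoord.open_target.measurableSet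
      fun p hp => ?_)) hlt
    have hp1 : 0 < p.1 := hp.1
    simp only [enorm_smul, smul_eq_mul]
    rw [Real.enorm_of_nonneg hp1.le]
  rw [← Complex.integral_comp_polarCoord_symm]
  have htar : polarCoord.target = Set.Ioi (0 : ℝ) ×ˢ Set.Ioo (-Real.pi) Real.pi := rfl
  rw [htar] at hint ⊢
  rw [Measure.volume_eq_prod, setIntegral_prod _ (by rwa [← Measure.volume_eq_prod])]
  refine setIntegral_congr_fun measurableSet_Ioi fun r _ => ?_
  simp only [Complex.polarCoord_symm_apply]
  rw [intervalIntegral.integral_of_le (by linarith [Real.pi_pos]), integral_Ioc_eq_integral_Ioo,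
    ← integral_const_mul]
  refine setIntegral_congr_fun measurableSet_Ioo fun θ _ => ?_
  simp only [Complex.exp_mul_I, Complex.real_smul, Complex.ofReal_cos, Complex.ofReal_sin]

/-- When `b` turns are run through at speed `1 - 1 / b`, the image runs through `b - 1` turns. -/
theorem sum_integral_comp_sub_mul {b : ℕ} (hb : 2 ≤ b) {h : ℝ → ℂ} (hc : Continuous h)
    (hper : Function.Periodic h (2 * Real.pi)) (χ : ℝ) :
    ∑ k ∈ Finset.range b, ∫ θ in -Real.pi..Real.pi,
        h (χ - ((b : ℝ) - 1) / b * (θ + 2 * Real.pi * k)) =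
      b * ∫ θ in -Real.pi..Real.pi, h θ := by
  have hb2 : (2 : ℝ) ≤ b := by exact_mod_cast hb
  set κ : ℝ := ((b : ℝ) - 1) / b with hκ
  have hκ0 : κ ≠ 0 := by
    rw [hκ]
    exact (div_pos (by linarith) (by linarith)).ne'
  have hshift : ∀ k ∈ Finset.range b, ∫ θ in -Real.pi..Real.pi, h (χ - κ * (θ + 2 * Real.pi * k)) =
      ∫ θ in (-Real.pi + 2 * Real.pi * k)..(-Real.pi + 2 * Real.pi * (k + 1 : ℕ)),
        h (χ - κ * θ) := by
    intro k _
    rw [intervalIntegral.integral_comp_add_right fun θ => h (χ - κ * θ)]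
    congr 1
    push_cast
    ring
  rw [Finset.sum_congr rfl hshift, intervalIntegral.sum_integral_adjacent_intervals
    (a := fun k : ℕ => -Real.pi + 2 * Real.pi * k) (f := fun θ => h (χ - κ * θ))
    (fun k _ => (by fun_prop : Continuous fun θ => h (χ - κ * θ)).intervalIntegrable _ _),
    intervalIntegral.integral_comp_sub_mul _ hκ0]
  have hend : χ - κ * (-Real.pi + 2 * Real.pi * ((0 : ℕ) : ℝ)) =
      (χ - κ * (-Real.pi + 2 * Real.pi * (b : ℝ))) + ((b - 1 : ℕ) : ℤ) • (2 * Real.pi) := by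
    rw [hκ, zsmul_eq_mul, Int.cast_natCast, Nat.cast_sub (by omega)]
    push_cast
    field_simp
    ring
  rw [hend, hper.intervalIntegral_add_zsmul_eq _ _ fun _ _ => hc.intervalIntegrable _ _,
    hper.intervalIntegral_add_eq _ (-Real.pi)]
  rw [show -Real.pi + 2 * Real.pi = Real.pi by ring, zsmul_eq_mul, Complex.real_smul, ← mul_assoc]
  congr 1
  rw [hκ, Int.cast_natCast, Nat.cast_sub (by omega)]
  have : (b : ℂ) - 1 ≠ 0 := by
    rw [sub_ne_zero]
    exact_mod_cast (by omega : b ≠ 1)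
  push_cast
  field_simp

theorem sum_roots_of_unity {E : Type*} [AddCommMonoid E] {b : ℕ} (hb : 0 < b) (g : ℂ → E) :
    ∑ ω ∈ Polynomial.nthRootsFinset b (1 : ℂ), g ω =
      ∑ k ∈ Finset.range b, g (Complex.exp (2 * Real.pi * Complex.I / b) ^ k) := by
  have hζ := Complex.isPrimitiveRoot_exp b hb.ne'
  rw [Polynomial.nthRootsFinset_def, Finset.sum, Multiset.toFinset_val,
    Multiset.dedup_eq_self.2 hζ.nthRoots_one_nodup, hζ.nthRoots_eq (one_pow b), Multiset.map_map]
  simp [Finset.sum]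

/-- The `b`-th roots of `r e ^ (i θ)` have arguments `(θ + 2 π k) / b`. -/
theorem linRootSum_polar {b : ℕ} (hb : 2 ≤ b) (f : ℂ → ℂ) (a : ℝ) (p : ℂ) {r : ℝ}
    (hr : 0 < r) (θ : ℝ) :
    linRootSum b f a p (r * Complex.exp (θ * Complex.I)) = ∑ k ∈ Finset.range b,
      f (((a * ‖p‖ / b * r ^ (-(((b : ℝ) - 1) / b)) : ℝ) : ℂ) * Complex.exp
        ((p.arg - ((b : ℝ) - 1) / b * (θ + 2 * Real.pi * k) : ℝ) * Complex.I)) := by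
  have hb0 : (b : ℂ) ≠ 0 := by exact_mod_cast (by omega : b ≠ 0)
  have hbR : (b : ℝ) ≠ 0 := by exact_mod_cast (by omega : b ≠ 0)
  set τ : ℂ := ((r ^ (b : ℝ)⁻¹ : ℝ) : ℂ) * Complex.exp (θ / b * Complex.I) with hτ
  have hr' : 0 < r ^ (b : ℝ)⁻¹ := Real.rpow_pos_of_pos hr _
  have hrC : ((r ^ (b : ℝ)⁻¹ : ℝ) : ℂ) ≠ 0 := by exact_mod_cast hr'.ne'
  have hτ0 : τ ≠ 0 := mul_ne_zero hrC (Complex.exp_ne_zero _)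
  have hτb : (r : ℂ) * Complex.exp (θ * Complex.I) = 1 * τ ^ b := by
    rw [one_mul, hτ, mul_pow, ← Complex.exp_nat_mul, ← Complex.ofReal_pow,
      Real.rpow_inv_natCast_pow hr.le (by omega)]
    congr 2
    field_simp
  unfold linRootSum
  rw [sum_nthRootsFinset_mul (by omega) hτ0 hτb, sum_roots_of_unity (by omega)]
  refine Finset.sum_congr rfl fun k _ => ?_
  congr 1
  have hpow : (r ^ (b : ℝ)⁻¹) ^ (b - 1) = (r ^ (-(((b : ℝ) - 1) / b)))⁻¹ := by
    rw [← Real.rpow_neg hr.le, neg_neg, ← Real.rpow_natCast, ← Real.rpow_mul hr.le,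
      Nat.cast_sub (by omega)]
    congr 1
    push_cast
    field_simp
  have hbase : (Complex.exp (2 * Real.pi * Complex.I / b) ^ k * τ) ^ (b - 1) =
      (((r ^ (-(((b : ℝ) - 1) / b)) : ℝ) : ℂ))⁻¹ *
        Complex.exp ((((b : ℝ) - 1) / b * (θ + 2 * Real.pi * k) : ℝ) * Complex.I) := by
    rw [hτ, ← Complex.ofReal_inv, ← hpow, Complex.ofReal_pow, ← Complex.exp_nat_mul, ← mul_assoc,
      mul_comm (Complex.exp _) _, mul_assoc, ← Complex.exp_add, mul_pow, ← Complex.exp_nat_mul]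
    congr 2
    rw [Nat.cast_sub (by omega)]
    push_cast
    field_simp
    ring
  have hp : p = ‖p‖ * Complex.exp (p.arg * Complex.I) := (Complex.norm_mul_exp_arg_mul_I p).symm
  rw [hbase]
  have hexp : Complex.exp ((p.arg - ((b : ℝ) - 1) / b * (θ + 2 * Real.pi * k) : ℝ) * Complex.I) =
      Complex.exp (p.arg * Complex.I) *
      (Complex.exp ((((b : ℝ) - 1) / b * (θ + 2 * Real.pi * k) : ℝ) * Complex.I))⁻¹ := by
    rw [← Complex.exp_neg, ← Complex.exp_add]
    congr 1
    push_cast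
    ring
  rw [hexp]
  nth_rewrite 1 [hp]
  push_cast
  have hne := Complex.exp_ne_zero
    ((((b : ℝ) - 1) / b * (θ + 2 * Real.pi * k) : ℝ) * Complex.I)
  push_cast at hne
  field_simp

/-- The density, as a function of the modulus, of the limit distribution contributed by one lattice
difference `p`, where `q = ε ‖p‖ / b`; it is normalised to the disk of radius `N`. -/
noncomputable def singleDensity (b : ℕ) (N q s : ℝ) : ℝ :=
  (Set.Ici q).indicator (fun s => b * ((b : ℝ) / (b - 1)) * q ^ (2 * ((b : ℝ) / (b - 1))) * N ^ 2 *
    s ^ (-(2 * ((b : ℝ) / (b - 1)) + 2))) s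

theorem singleDensity_nonneg {b : ℕ} (hb : 2 ≤ b) (N : ℝ) {q : ℝ} (hq : 0 ≤ q) (s : ℝ) :
    0 ≤ singleDensity b N q s := by
  have hb2 : (2 : ℝ) ≤ b := by exact_mod_cast hb
  refine Set.indicator_apply_nonneg fun hs => ?_
  have hs0 : 0 ≤ s := hq.trans hs
  have : 0 ≤ (b : ℝ) / (b - 1) := div_nonneg (by linarith) (by linarith)
  positivity

variable {f : ℂ → ℂ} {A M K η : ℝ}

theorem measurable_singleDensity (b : ℕ) (N q : ℝ) : Measurable (singleDensity b N q) :=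
  Measurable.indicator (by fun_prop) measurableSet_Ici

theorem singleDensity_le {b : ℕ} (hb : 2 ≤ b) (N : ℝ) {q : ℝ} (hq : 0 < q) (s : ℝ) :
    singleDensity b N q s ≤ b * ((b : ℝ) / (b - 1)) * q ^ (2 * ((b : ℝ) / (b - 1))) * N ^ 2 *
      q ^ (-(2 * ((b : ℝ) / (b - 1)) + 2)) := by
  have hb2 : (2 : ℝ) ≤ b := by exact_mod_cast hb
  have hβ : 0 ≤ (b : ℝ) / (b - 1) := div_nonneg (by linarith) (by linarith)
  refine Set.indicator_apply_le' (fun hs => ?_) fun _ => by positivity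
  exact mul_le_mul_of_nonneg_left (Real.rpow_le_rpow_of_nonpos hq hs (by linarith)) (by positivity)

theorem IsTestFunction.integrable (hf : IsTestFunction f A M K η) : Integrable f := by
  refine hf.continuous.integrable_of_hasCompactSupport
    (HasCompactSupport.intro (isCompact_closedBall 0 A) fun z hz => hf.eq_zero z ?_)
  rw [mem_closedBall_zero_iff, not_le] at hz
  exact hz.le

theorem integrable_mul_singleDensity (hf : IsTestFunction f A M K η) {b : ℕ} (hb : 2 ≤ b) (N : ℝ)
    {q : ℝ} (hq : 0 < q) : Integrable fun z => f z * (singleDensity b N q ‖z‖ : ℂ) := by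
  refine hf.integrable.mul_bdd (c := b * ((b : ℝ) / (b - 1)) * q ^ (2 * ((b : ℝ) / (b - 1))) *
    N ^ 2 * q ^ (-(2 * ((b : ℝ) / (b - 1)) + 2))) ?_ (Eventually.of_forall fun z => ?_)
  · exact (Complex.measurable_ofReal.comp
      ((measurable_singleDensity b N q).comp measurable_norm)).aestronglyMeasurable
  · rw [Complex.norm_real, Real.norm_of_nonneg (singleDensity_nonneg hb N hq.le _)]
    exact singleDensity_le hb N hq _

/-- The change of variables `z = a p / (b u ^ (b - 1))`, where `u` runs through the roots of the
points of the disk of radius `N`. -/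
theorem integral_linRootSum (hf : IsTestFunction f A M K η) {b : ℕ} (hb : 2 ≤ b)
    {ε ν N : ℝ} (hν : 0 < ν) (hN : N = ν ^ b) (hε : 0 < ε) {p : ℂ} (hp : p ≠ 0) :
    ∫ x in Metric.closedBall 0 N, linRootSum b f (ε * ν ^ (b - 1)) p x =
      ∫ z, f z * (singleDensity b N (ε * ‖p‖ / b) ‖z‖ : ℂ) := by
  have hb2 : (2 : ℝ) ≤ b := by exact_mod_cast hb
  have hb0 : (0 : ℝ) < b := by linarith
  have hb1 : (0 : ℝ) < b - 1 := by linarith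
  have hp0 : 0 < ‖p‖ := norm_pos_iff.2 hp
  set a := ε * ν ^ (b - 1) with ha
  have ha0 : 0 < a := by positivity
  set q := ε * ‖p‖ / b with hq
  have hq0 : 0 < q := by positivity
  set κ : ℝ := ((b : ℝ) - 1) / b with hκ
  have hκ0 : 0 < κ := by positivity
  set β : ℝ := (b : ℝ) / (b - 1) with hβ
  have hβ0 : 0 < β := by positivity
  have hκβ : κ * β = 1 := by rw [hκ, hβ]; field_simp
  set c := a * ‖p‖ / b with hc
  have hc0 : 0 < c := by positivity
  have hN0 : 0 < N := by rw [hN]; positivity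
  have hqc : q = c * N ^ (-κ) := by
    rw [hq, hc, ha, hN, ← Real.rpow_natCast ν b, ← Real.rpow_mul hν.le,
      show (b : ℝ) * -κ = -((b - 1 : ℕ) : ℝ) by
        rw [hκ, Nat.cast_sub (by omega)]
        push_cast
        field_simp,
      Real.rpow_neg hν.le, Real.rpow_natCast]
    field_simp
  set Φ : ℝ → ℂ := fun s => ∫ θ in -Real.pi..Real.pi, f (s * Complex.exp (θ * Complex.I)) with hΦ
  -- A measurable representative of the integrand on the left.
  set g : ℂ → ℂ := (Metric.closedBall 0 N).indicator fun x =>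
    ∑ ω ∈ Polynomial.nthRootsFinset b (1 : ℂ),
      f (a * p / (b * (ω * x ^ (b : ℂ)⁻¹) ^ (b - 1))) with hg
  have hgm : Measurable g := by
    refine Measurable.indicator ?_ measurableSet_closedBall
    have := hf.continuous.measurable
    fun_prop
  have hgeq (x : ℂ) (hx : x ≠ 0) :
      g x = (Metric.closedBall 0 N).indicator (linRootSum b f a p) x := by
    classical
    rw [hg, Set.indicator_apply, Set.indicator_apply,
      linRootSum_eq_sum_roots_of_unity (by omega) f a p hx]
  have hgae : (Metric.closedBall 0 N).indicator (linRootSum b f a p) =ᵐ[volume] g := by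
    filter_upwards [ae_ne_zero] with x hx
    exact (hgeq x hx).symm
  have hgi : Integrable g := by
    refine Integrable.congr ?_ hgae
    rw [integrable_indicator_iff measurableSet_closedBall]
    exact integrableOn_linRootSum hf (by omega) a p N
  have hleft : ∫ x in Metric.closedBall 0 N, linRootSum b f a p x =
      ∫ r in Set.Ioi (0 : ℝ), (r : ℂ) * ((Set.Iic N).indicator
        (fun r => b * Φ (c * r ^ (-κ))) r) := by
    rw [← integral_indicator measurableSet_closedBall, integral_congr_ae hgae,
      integral_eq_integral_polar hgm hgi]
    refine setIntegral_congr_fun measurableSet_Ioi fun r hr => ?_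
    have hr' : 0 < r := hr
    have hnorm (θ : ℝ) : ‖(r : ℂ) * Complex.exp (θ * Complex.I)‖ = r := by
      rw [norm_mul, Complex.norm_exp_ofReal_mul_I, mul_one, Complex.norm_real,
        Real.norm_of_nonneg hr'.le]
    have hne (θ : ℝ) : (r : ℂ) * Complex.exp (θ * Complex.I) ≠ 0 := by
      rw [← norm_pos_iff, hnorm]
      exact hr'
    simp only [hgeq _ (hne _)]
    congr 1
    by_cases hrN : r ≤ N
    · rw [Set.indicator_of_mem (by exact hrN)]
      have hmem (θ : ℝ) : (r : ℂ) * Complex.exp (θ * Complex.I) ∈ Metric.closedBall (0 : ℂ) N := by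
        rw [mem_closedBall_zero_iff, hnorm]
        exact hrN
      simp only [Set.indicator_of_mem (hmem _), linRootSum_polar hb f a p hr']
      have hcont := hf.continuous
      rw [intervalIntegral.integral_finsetSum fun k _ =>
        (by fun_prop : Continuous _).intervalIntegrable _ _]
      exact sum_integral_comp_sub_mul hb
        (h := fun φ => f (((c * r ^ (-κ) : ℝ) : ℂ) * Complex.exp (φ * Complex.I)))
        (by fun_prop) (fun φ => by
          have : Complex.exp ((φ + 2 * Real.pi) * Complex.I) = Complex.exp (φ * Complex.I) :=
            Complex.exp_mul_I_periodic (φ : ℂ)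
          simp only [Complex.ofReal_add, Complex.ofReal_mul, Complex.ofReal_ofNat]
          rw [this]) p.arg
    · rw [Set.indicator_of_notMem (by exact hrN)]
      have hmem (θ : ℝ) :
          (r : ℂ) * Complex.exp (θ * Complex.I) ∉ Metric.closedBall (0 : ℂ) N := by
        rw [mem_closedBall_zero_iff, hnorm]
        exact hrN
      simp only [Set.indicator_of_notMem (hmem _), intervalIntegral.integral_zero]
  have hright : ∫ z, f z * (singleDensity b N q ‖z‖ : ℂ) =
      ∫ s in Set.Ioi (0 : ℝ), (s : ℂ) * ((singleDensity b N q s : ℂ) * Φ s) := by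
    rw [integral_eq_integral_polar _ (integrable_mul_singleDensity hf hb N hq0)]
    · refine setIntegral_congr_fun measurableSet_Ioi fun s hs => ?_
      have hs' : 0 < s := hs
      have hnorm (θ : ℝ) : ‖(s : ℂ) * Complex.exp (θ * Complex.I)‖ = s := by
        rw [norm_mul, Complex.norm_exp_ofReal_mul_I, mul_one, Complex.norm_real,
          Real.norm_of_nonneg hs'.le]
      simp only [hnorm]
      rw [intervalIntegral.integral_mul_const, mul_comm (_ : ℂ) (singleDensity b N q s : ℂ)]
    · have h1 := measurable_singleDensity b N q
      have h2 := hf.continuous.measurable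
      fun_prop
  rw [hleft, hright]
  have hscale := integral_comp_mul_left_Ioi
    (fun s : ℝ => (s : ℂ) * ((singleDensity b N q s : ℂ) * Φ s)) 0 hc0
  rw [mul_zero] at hscale
  rw [← smul_right_injective ℂ (inv_ne_zero hc0.ne') |>.eq_iff, ← hscale,
    ← integral_comp_rpow_Ioi
      (fun y : ℝ => ((c * y : ℝ) : ℂ) * ((singleDensity b N q (c * y) : ℂ) * Φ (c * y)))
      (neg_ne_zero.2 hκ0.ne'), ← integral_smul]
  refine setIntegral_congr_fun measurableSet_Ioi fun r hr => ?_
  have hr' : 0 < r := hr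
  by_cases hrN : r ≤ N
  · have hmem : c * r ^ (-κ) ∈ Set.Ici q := by
      rw [Set.mem_Ici, hqc]
      exact mul_le_mul_of_nonneg_left (Real.rpow_le_rpow_of_nonpos hr' hrN (by linarith)) hc0.le
    simp only [singleDensity]
    rw [Set.indicator_of_mem (by exact hrN), Set.indicator_of_mem hmem, ← hβ]
    have hq2 : q ^ (2 * β) = c ^ (2 * β) * (N ^ 2)⁻¹ := by
      rw [hqc, Real.mul_rpow hc0.le (by positivity), ← Real.rpow_mul hN0.le,
        show -κ * (2 * β) = -((2 : ℕ) : ℝ) by push_cast; linarith, Real.rpow_neg hN0.le,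
        Real.rpow_natCast]
    have hs2 : (c * r ^ (-κ)) ^ (-(2 * β + 2)) = (c ^ (2 * β))⁻¹ * (c ^ 2)⁻¹ *
        (r ^ 2 * (r ^ κ) ^ 2) := by
      rw [Real.mul_rpow hc0.le (by positivity), ← Real.rpow_mul hr'.le,
        show -κ * -(2 * β + 2) = ((2 : ℕ) : ℝ) + κ * (2 : ℕ) by push_cast; linarith,
        Real.rpow_add hr', Real.rpow_mul hr'.le, Real.rpow_natCast, Real.rpow_natCast,
        Real.rpow_neg hc0.le, Real.rpow_add hc0, mul_inv]
      congr 2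
      norm_cast
    have hr1 : r ^ (-κ - 1) = (r ^ κ)⁻¹ * r⁻¹ := by
      rw [Real.rpow_sub_one hr'.ne', Real.rpow_neg hr'.le, div_eq_mul_inv]
    have hrk : 0 < r ^ κ := Real.rpow_pos_of_pos hr' _
    have hcβ : 0 < c ^ (2 * β) := Real.rpow_pos_of_pos hc0 _
    have key : c⁻¹ * (r * b) = (|-κ| * r ^ (-κ - 1)) * ((c * r ^ (-κ)) *
        (b * β * q ^ (2 * β) * N ^ 2 * (c * r ^ (-κ)) ^ (-(2 * β + 2)))) := by
      rw [hq2, hs2, hr1, Real.rpow_neg hr'.le, abs_neg, abs_of_pos hκ0]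
      have : κ = β⁻¹ := eq_inv_of_mul_eq_one_left hκβ
      field_simp
      rw [hκβ]
    simp only [Complex.real_smul]
    have keyC := congrArg (fun x : ℝ => (x : ℂ)) key
    simp only [Complex.ofReal_mul, Complex.ofReal_natCast] at keyC
    have e1 : ((c⁻¹ : ℝ) : ℂ) * ((r : ℂ) * (b * Φ (c * r ^ (-κ)))) =
      (((c⁻¹ : ℝ) : ℂ) * (r * b)) * Φ (c * r ^ (-κ)) := by ring
    rw [e1, keyC]
    push_cast
    ring
  · have hmem : c * r ^ (-κ) ∉ Set.Ici q := by
      rw [Set.mem_Ici, hqc, not_le]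
      push Not at hrN
      exact mul_lt_mul_of_pos_left (Real.rpow_lt_rpow_of_neg hN0 hrN (by linarith)) hc0
    simp only [singleDensity]
    rw [Set.indicator_of_notMem (by exact hrN), Set.indicator_of_notMem hmem]
    simp

end

/-! ### Power sums over the lattice and the critical density -/

/-- The sum of `‖p‖ ^ s` over the lattice points `p` of modulus at most `t`. -/
noncomputable def latticeSum (L : Submodule ℤ ℂ) (s t : ℝ) : ℝ :=
  ∑' p : {p : ℂ // p ∈ L ∧ ‖p‖ ≤ t}, ‖p.1‖ ^ s

theorem latticeSum_eq_sum {L : Submodule ℤ ℂ} {s t : ℝ} (hs : 0 < s) {F : Finset ℂ}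
    (hFL : ∀ p ∈ F, p ∈ L) (hF : ∀ p ∈ L, p ≠ 0 → ‖p‖ ≤ t → p ∈ F) :
    latticeSum L s t = ∑ p ∈ F, if ‖p‖ ≤ t then ‖p‖ ^ s else 0 := by
  classical
  unfold latticeSum
  refine (tsum_subtype {p : ℂ | p ∈ L ∧ ‖p‖ ≤ t} fun p => ‖p‖ ^ s).trans ?_
  rw [tsum_eq_sum (s := F)]
  · refine Finset.sum_congr rfl fun p hp => ?_
    by_cases h : ‖p‖ ≤ t
    · rw [if_pos h, Set.indicator_of_mem]
      exact ⟨hFL p hp, h⟩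
    · rw [if_neg h, Set.indicator_of_notMem]
      exact fun h' => h h'.2
  · intro p hp
    refine Set.indicator_apply_eq_zero.2 fun hmem => ?_
    by_cases h0 : p = 0
    · rw [h0, norm_zero, Real.zero_rpow hs.ne']
    · exact absurd (hF p hmem.1 h0 hmem.2) hp

section Tiling

variable {L : Submodule ℤ ℂ} {D : ℝ} {fl : ℂ → ℂ}

/-- The lattice points other than `0` of modulus at most `t`. -/
noncomputable def IsUnitTiling.points (h : IsUnitTiling (L : Set ℂ) D fl) (t : ℝ) :
    Finset ℂ :=
  ((h.finite_inter_closedBall t).sdiff (t := {0})).toFinset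

theorem IsUnitTiling.mem_points (h : IsUnitTiling (L : Set ℂ) D fl) {t : ℝ} {p : ℂ} :
    p ∈ h.points t ↔ p ∈ L ∧ ‖p‖ ≤ t ∧ p ≠ 0 := by
  simp [IsUnitTiling.points, and_assoc]

theorem card_le_of_le_norm (h : IsUnitTiling (L : Set ℂ) D fl) {σ t : ℝ} (hσ : 0 < σ)
    {F : Finset ℂ} (hFL : (F : Set ℂ) ⊆ L) (hσF : ∀ p ∈ F, σ ≤ ‖p‖) (ht : ∀ p ∈ F, ‖p‖ ≤ t) :
    (F.card : ℝ) ≤ Real.pi * (1 + D / σ) ^ 2 * t ^ 2 := by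
  have hπ := Real.pi_pos
  have hD := h.D_nonneg
  rcases F.eq_empty_or_nonempty with rfl | ⟨p, hp⟩
  · simp only [Finset.card_empty, Nat.cast_zero]
    positivity
  refine (h.card_le hFL ht).trans ?_
  have hσt : σ ≤ t := (hσF p hp).trans (ht p hp)
  have : t + D ≤ (1 + D / σ) * t := by
    have : D ≤ D / σ * t := by
      rw [div_mul_eq_mul_div, le_div_iff₀ hσ]
      gcongr
    linarith
  rw [mul_assoc, ← mul_pow]
  have h0 : 0 ≤ t + D := by linarith
  gcongr

theorem sum_inv_norm_le_of_le_norm (h : IsUnitTiling (L : Set ℂ) D fl) {σ t : ℝ} (hσ : 0 < σ)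
    (ht0 : 0 ≤ t) {F : Finset ℂ} (hFL : (F : Set ℂ) ⊆ L) (hσF : ∀ p ∈ F, σ ≤ ‖p‖)
    (ht : ∀ p ∈ F, ‖p‖ ≤ t) : ∑ p ∈ F, ‖p‖⁻¹ ≤ 2 * Real.pi * (1 + D / σ) ^ 2 * t := by
  have hπ := Real.pi_pos
  have hD := h.D_nonneg
  rcases F.eq_empty_or_nonempty with rfl | ⟨p, hp⟩
  · simp only [Finset.sum_empty]
    positivity
  refine (h.sum_inv_norm_le hFL hσ hσF ht0 ht).trans ?_
  have hσt : σ ≤ t := (hσF p hp).trans (ht p hp)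
  have : t + D ≤ (1 + D / σ) * t := by
    have : D ≤ D / σ * t := by
      rw [div_mul_eq_mul_div, le_div_iff₀ hσ]
      gcongr
    linarith
  calc (1 + D / σ) * (2 * Real.pi * (t + D))
      ≤ (1 + D / σ) * (2 * Real.pi * ((1 + D / σ) * t)) := by gcongr
    _ = _ := by ring

theorem latticeSum_nonneg (L : Submodule ℤ ℂ) (s t : ℝ) : 0 ≤ latticeSum L s t :=
  tsum_nonneg fun _ => Real.rpow_nonneg (norm_nonneg _) _

theorem latticeSum_eq_sum_points (h : IsUnitTiling (L : Set ℂ) D fl) {s : ℝ} (hs : 0 < s) (t : ℝ) :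
    latticeSum L s t = ∑ p ∈ h.points t, ‖p‖ ^ s := by
  rw [latticeSum_eq_sum (F := h.points t) hs (fun p hp => (h.mem_points.1 hp).1)
    fun p hp h0 ht => h.mem_points.2 ⟨hp, ht, h0⟩]
  exact Finset.sum_congr rfl fun p hp => if_pos (h.mem_points.1 hp).2.1

theorem latticeSum_mono (h : IsUnitTiling (L : Set ℂ) D fl) {s : ℝ} (hs : 0 < s) :
    Monotone (latticeSum L s) := by
  intro t₁ t₂ h12
  rw [latticeSum_eq_sum_points h hs, latticeSum_eq_sum_points h hs]
  refine Finset.sum_le_sum_of_subset_of_nonneg (fun p hp => ?_) fun p _ _ =>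
    Real.rpow_nonneg (norm_nonneg _) _
  rw [h.mem_points] at hp ⊢
  exact ⟨hp.1, hp.2.1.trans h12, hp.2.2⟩

theorem latticeSum_le (h : IsUnitTiling (L : Set ℂ) D fl) {s σ t : ℝ} (hs : 0 < s) (hσ : 0 < σ)
    (hσL : ∀ p ∈ L, p ≠ 0 → σ ≤ ‖p‖) (ht : 0 ≤ t) :
    latticeSum L s t ≤ Real.pi * (1 + D / σ) ^ 2 * t ^ 2 * t ^ s := by
  rw [latticeSum_eq_sum_points h hs]
  calc ∑ p ∈ h.points t, ‖p‖ ^ s ≤ ∑ p ∈ h.points t, t ^ s := by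
        refine Finset.sum_le_sum fun p hp => ?_
        have := (h.mem_points.1 hp).2.1
        gcongr
    _ = (h.points t).card * t ^ s := by rw [Finset.sum_const, nsmul_eq_mul]
    _ ≤ _ := by
        gcongr
        refine card_le_of_le_norm h hσ (fun p hp => (h.mem_points.1 hp).1) (fun p hp => ?_)
          fun p hp => (h.mem_points.1 hp).2.1
        obtain ⟨h1, -, h3⟩ := h.mem_points.1 hp
        exact hσL p h1 h3

theorem integral_norm_rpow_unit_disk {s : ℝ} (hs : 0 < s) :
    ∫ y : ℂ, (Set.Iic 1).indicator (fun r : ℝ => r ^ s) ‖y‖ = 2 * Real.pi / (s + 2) := by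
  rw [integral_fun_norm_addHaar volume ((Set.Iic 1).indicator fun r : ℝ => r ^ s)]
  have heq : Set.EqOn (fun y : ℝ => y ^ (Module.finrank ℝ ℂ - 1) •
      (Set.Iic 1).indicator (fun r : ℝ => r ^ s) y)
      ((Set.Iic 1).indicator fun r : ℝ => r ^ (s + 1)) (Set.Ioi 0) := by
    intro y hy
    have hy' : (0 : ℝ) < y := hy
    by_cases hyR : y ∈ Set.Iic (1 : ℝ)
    · simp only [Set.indicator_of_mem hyR]
      rw [Real.rpow_add_one hy'.ne']
      simp [mul_comm]
    · simp [hyR]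
  rw [setIntegral_congr_fun measurableSet_Ioi heq, setIntegral_indicator measurableSet_Iic,
    show Set.Ioi (0 : ℝ) ∩ Set.Iic 1 = Set.Ioc 0 1 from rfl,
    ← intervalIntegral.integral_of_le zero_le_one, integral_rpow (Or.inl (by linarith))]
  rw [Real.one_rpow, Real.zero_rpow (by linarith)]
  simp [measureReal_def, Complex.volume_ball]
  ring

/-- Riemann sums of `‖y‖ ^ s` over the lattice scaled by `1 / t`. -/
theorem tendsto_latticeSum_div (h : IsUnitTiling (L : Set ℂ) D fl) {s : ℝ} (hs : 0 < s) :
    Tendsto (fun t : ℝ => latticeSum L s t / t ^ (s + 2)) atTop (𝓝 (2 * Real.pi / (s + 2))) := by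
  have hD := h.D_nonneg
  set g : ℝ → ℂ → ℝ := fun t y => t ^ (-s) *
    (fl ⁻¹' (h.points t : Set ℂ)).indicator (fun x => ‖fl x‖ ^ s) (t • y) with hg
  have hPL (t : ℝ) : (h.points t : Set ℂ) ⊆ L := fun p hp => (h.mem_points.1 hp).1
  have hval : ∀ t y, 0 < t → g t y = (Set.Iic 1).indicator (fun r : ℝ => r ^ s)
      (t⁻¹ * ‖fl (t • y)‖) := by
    intro t y ht
    have hiff : t⁻¹ * ‖fl (t • y)‖ ≤ 1 ↔ ‖fl (t • y)‖ ≤ t := by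
      rw [inv_mul_le_iff₀ ht, mul_one]
    simp only [hg]
    by_cases h1 : fl (t • y) ∈ h.points t
    · have h2 := (h.mem_points.1 h1).2.1
      rw [Set.indicator_of_mem (by simpa using h1), Set.indicator_of_mem (by exact hiff.2 h2),
        Real.mul_rpow (by positivity) (norm_nonneg _), Real.inv_rpow ht.le, Real.rpow_neg ht.le]
    · rw [Set.indicator_of_notMem (by simpa using h1), mul_zero]
      symm
      refine Set.indicator_apply_eq_zero.2 fun hmem => ?_
      by_cases h0 : fl (t • y) = 0
      · rw [h0, norm_zero, mul_zero, Real.zero_rpow hs.ne']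
      · exact absurd (h.mem_points.2 ⟨h.mem _, hiff.1 hmem, h0⟩) h1
  have hint : ∀ᶠ t : ℝ in atTop, ∫ y, g t y = latticeSum L s t / t ^ (s + 2) := by
    filter_upwards [eventually_gt_atTop 0] with t ht
    simp only [hg]
    rw [integral_const_mul, Measure.integral_comp_smul volume
      ((fl ⁻¹' (h.points t : Set ℂ)).indicator fun x => ‖fl x‖ ^ s) t,
      h.integral_indicator (hPL t) fun p => ‖p‖ ^ s, ← latticeSum_eq_sum_points h hs,
      Complex.finrank_real_complex, smul_eq_mul, abs_of_pos (by positivity),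
      Real.rpow_add ht, Real.rpow_neg ht.le, Real.rpow_ofNat]
    field_simp
  refine Tendsto.congr' hint ?_
  rw [← integral_norm_rpow_unit_disk hs]
  refine tendsto_integral_filter_of_dominated_convergence
    ((Metric.closedBall (0 : ℂ) (1 + D)).indicator fun _ => 1) ?_ ?_ ?_ ?_
  · filter_upwards [eventually_gt_atTop 0] with t ht
    exact (((h.integrable_indicator (hPL t) fun p => ‖p‖ ^ s).comp_smul ht.ne').const_mul _).1
  · filter_upwards [eventually_ge_atTop 1] with t ht
    refine Eventually.of_forall fun y => ?_
    have ht0 : 0 < t := by linarith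
    rw [hval t y ht0]
    by_cases hmem : t⁻¹ * ‖fl (t • y)‖ ∈ Set.Iic (1 : ℝ)
    · have h1 : t⁻¹ * ‖fl (t • y)‖ ≤ 1 := hmem
      rw [Set.indicator_of_mem hmem, Real.norm_of_nonneg (by positivity), Set.indicator_of_mem]
      · exact Real.rpow_le_one (by positivity) h1 hs.le
      · rw [mem_closedBall_zero_iff]
        rw [inv_mul_le_iff₀ ht0, mul_one] at h1
        have h2 := h.norm_le (t • y)
        rw [norm_smul, Real.norm_of_nonneg ht0.le] at h2
        have : t * ‖y‖ ≤ t * (1 + D) := by nlinarith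
        exact le_of_mul_le_mul_left this ht0
    · rw [Set.indicator_of_notMem hmem, norm_zero]
      exact Set.indicator_nonneg (fun _ _ => zero_le_one) _
  · rw [integrable_indicator_iff measurableSet_closedBall]
    exact integrableOn_const (by rw [Complex.volume_closedBall]; finiteness)
  · have hsphere : ∀ᵐ y : ℂ, ‖y‖ ≠ 1 := by
      have := Measure.addHaar_sphere (volume : Measure ℂ) 0 1
      rw [ae_iff]
      convert this using 2
      ext y
      simp
    filter_upwards [hsphere] with y hy
    have hlim : Tendsto (fun t : ℝ => t⁻¹ * ‖fl (t • y)‖) atTop (𝓝 ‖y‖) := by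
      rw [tendsto_iff_norm_sub_tendsto_zero]
      refine squeeze_zero' (Eventually.of_forall fun _ => norm_nonneg _) ?_
        (by simpa using tendsto_inv_atTop_zero.mul_const D : Tendsto (fun t : ℝ => t⁻¹ * D) atTop
          (𝓝 0))
      filter_upwards [eventually_gt_atTop 0] with t ht
      have h1 := h.norm_le (t • y)
      have h2 := h.norm_fl_le (t • y)
      rw [norm_smul, Real.norm_of_nonneg ht.le] at h1 h2
      rw [Real.norm_eq_abs, show t⁻¹ * ‖fl (t • y)‖ - ‖y‖ = t⁻¹ * (‖fl (t • y)‖ - t * ‖y‖) by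
        field_simp, abs_mul, abs_of_pos (inv_pos.2 ht)]
      gcongr
      rw [abs_le]
      constructor <;> linarith
    have hcont : ContinuousAt ((Set.Iic 1).indicator fun r : ℝ => r ^ s) ‖y‖ := by
      have hpow : ContinuousAt (fun r : ℝ => r ^ s) ‖y‖ :=
        Real.continuousAt_rpow_const _ _ (Or.inr hs.le)
      rcases lt_or_gt_of_ne hy with hlt | hgt
      · refine hpow.congr ?_
        filter_upwards [Iio_mem_nhds hlt] with r hr
        rw [Set.indicator_of_mem (show r ∈ Set.Iic 1 from le_of_lt (Set.mem_Iio.1 hr))]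
      · refine (continuousAt_const (y := (0 : ℝ))).congr ?_
        filter_upwards [Ioi_mem_nhds hgt] with r hr
        rw [Set.indicator_of_notMem (by simpa using hr)]
    refine (hcont.tendsto.comp hlim).congr' ?_
    filter_upwards [eventually_gt_atTop 0] with t ht
    exact (hval t y ht).symm

/-- The density at the critical exponent, in terms of `β = 1 / (1 - α) = b / (b - 1)`. -/
theorem density_critical {b : ℕ} (hb : 2 ≤ b) (L : Submodule ℤ ℂ) (z : ℂ) :
    density (1 / (b : ℝ)) (1 - 1 / b) L z =
      (b : ℝ) / (b - 1) * (b : ℝ) ^ (-(2 * ((b : ℝ) / (b - 1)))) *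
        ‖z‖ ^ (-(2 * ((b : ℝ) / (b - 1)) + 2)) *
          latticeSum L (2 * ((b : ℝ) / (b - 1))) (b * ‖z‖) := by
  have hb2 : (2 : ℝ) ≤ b := by exact_mod_cast hb
  have hb1 : (b : ℝ) - 1 ≠ 0 := by linarith
  have hb0 : (b : ℝ) ≠ 0 := by linarith
  have hα : (1 - 1 / (b : ℝ)) ≠ 0 := by
    rw [one_sub_div hb0]
    exact div_ne_zero hb1 hb0
  unfold density latticeSum
  rw [if_neg (lt_irrefl _), if_neg (lt_irrefl _)]
  have e1 : 2 / (1 - 1 / (b : ℝ)) = 2 * (b / (b - 1)) := by field_simp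
  have e2 : (4 - 2 * (1 / (b : ℝ))) / (1 - 1 / b) = 2 * (b / (b - 1)) + 2 := by
    field_simp
    ring
  have e3 : ‖z‖ / (1 / (b : ℝ)) = b * ‖z‖ := by field_simp
  have e4 : (1 / (b : ℝ)) ^ (2 * ((b : ℝ) / (b - 1))) / (1 - 1 / b) =
      (b : ℝ) / (b - 1) * (b : ℝ) ^ (-(2 * ((b : ℝ) / (b - 1)))) := by
    rw [one_div, Real.inv_rpow (by positivity), Real.rpow_neg (by positivity)]
    field_simp
  rw [e1, e2, e3, e4]

theorem density_critical_nonneg {b : ℕ} (hb : 2 ≤ b) (L : Submodule ℤ ℂ) (z : ℂ) :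
    0 ≤ density (1 / (b : ℝ)) (1 - 1 / b) L z := by
  rw [density_critical hb]
  have hb2 : (2 : ℝ) ≤ b := by exact_mod_cast hb
  have h1 : (0 : ℝ) ≤ b / (b - 1) := div_nonneg (by linarith) (by linarith)
  have := latticeSum_nonneg L (2 * ((b : ℝ) / (b - 1))) (b * ‖z‖)
  positivity

theorem measurable_density_critical {b : ℕ} (hb : 2 ≤ b) (h : IsUnitTiling (L : Set ℂ) D fl) :
    Measurable (density (1 / (b : ℝ)) (1 - 1 / b) L) := by
  have hb2 : (2 : ℝ) ≤ b := by exact_mod_cast hb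
  have h1 : (0 : ℝ) < b / (b - 1) := div_pos (by linarith) (by linarith)
  have h2 := (latticeSum_mono h (s := 2 * ((b : ℝ) / (b - 1))) (by positivity)).measurable
  have h3 : density (1 / (b : ℝ)) (1 - 1 / b) L = _ := funext fun z => density_critical hb L z
  rw [h3]
  fun_prop

theorem exists_density_critical_le {b : ℕ} (hb : 2 ≤ b) (h : IsUnitTiling (L : Set ℂ) D fl) :
    ∃ B : ℝ, ∀ z, density (1 / (b : ℝ)) (1 - 1 / b) L z ≤ B := by
  have hb2 : (2 : ℝ) ≤ b := by exact_mod_cast hb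
  have hβ : (0 : ℝ) < b / (b - 1) := div_pos (by linarith) (by linarith)
  obtain ⟨σ, hσ, hσL⟩ := h.exists_pos_le_norm
  have hD := h.D_nonneg
  have hπ := Real.pi_pos
  set β : ℝ := b / (b - 1)
  refine ⟨β * (Real.pi * (1 + D / σ) ^ 2 * b ^ 2), fun z => ?_⟩
  rw [density_critical hb]
  rcases eq_or_ne z 0 with rfl | hz
  · rw [norm_zero, Real.zero_rpow (neg_ne_zero.2 (by positivity)), mul_zero, zero_mul]
    positivity
  have hz0 : 0 < ‖z‖ := norm_pos_iff.2 hz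
  have hle := latticeSum_le h (s := 2 * β) (t := b * ‖z‖) (by positivity) hσ hσL (by positivity)
  calc β * (b : ℝ) ^ (-(2 * β)) * ‖z‖ ^ (-(2 * β + 2)) * latticeSum L (2 * β) (b * ‖z‖)
      ≤ β * (b : ℝ) ^ (-(2 * β)) * ‖z‖ ^ (-(2 * β + 2)) *
        (Real.pi * (1 + D / σ) ^ 2 * (b * ‖z‖) ^ 2 * (b * ‖z‖) ^ (2 * β)) := by gcongr
    _ = _ := by
      rw [Real.mul_rpow (by positivity) hz0.le, Real.rpow_neg (by positivity),
        Real.rpow_neg hz0.le, Real.rpow_add hz0, Real.rpow_ofNat]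
      have h1 : (b : ℝ) ^ (2 * β) ≠ 0 := by positivity
      have h2 : ‖z‖ ^ (2 * β) ≠ 0 := by positivity
      field_simp

/-- Far from the origin, the critical density approaches the density of the Poisson regime. -/
theorem tendsto_density_critical {b : ℕ} (hb : 2 ≤ b) (h : IsUnitTiling (L : Set ℂ) D fl) {z : ℂ}
    (hz : z ≠ 0) :
    Tendsto (fun t : ℝ => density (1 / (b : ℝ)) (1 - 1 / b) L (t • z)) atTop
      (𝓝 (Real.pi / ((1 / (b : ℝ)) ^ 2 * (2 - 1 / b)))) := by
  have hb2 : (2 : ℝ) ≤ b := by exact_mod_cast hb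
  have hβ : (0 : ℝ) < b / (b - 1) := div_pos (by linarith) (by linarith)
  have hz0 : 0 < ‖z‖ := norm_pos_iff.2 hz
  set β : ℝ := b / (b - 1) with hβdef
  have hlim := ((tendsto_latticeSum_div h (s := 2 * β) (by positivity)).comp
    (tendsto_id.atTop_mul_const (by positivity : 0 < b * ‖z‖))).const_mul (β * b ^ 2)
  have hval : β * (b : ℝ) ^ 2 * (2 * Real.pi / (2 * β + 2)) =
      Real.pi / ((1 / (b : ℝ)) ^ 2 * (2 - 1 / b)) := by
    have h1 : (b : ℝ) - 1 ≠ 0 := by linarith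
    have h2 : 2 * (b : ℝ) - 1 ≠ 0 := by linarith
    have e1 : 2 * β + 2 = 2 * (2 * b - 1) / (b - 1) := by
      rw [hβdef]
      field_simp
      ring
    have e2 : (2 - 1 / (b : ℝ)) = (2 * b - 1) / b := by
      field_simp
    rw [e1, e2, hβdef]
    field_simp
  rw [hval] at hlim
  refine hlim.congr' ?_
  filter_upwards [eventually_gt_atTop 0] with t ht
  rw [density_critical hb, norm_smul, Real.norm_of_nonneg ht.le, ← hβdef]
  have hT : 0 < t * ‖z‖ := by positivity
  simp only [Function.comp_apply, id]
  rw [show t * (b * ‖z‖) = b * (t * ‖z‖) by ring, Real.mul_rpow (by positivity) hT.le,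
    Real.rpow_add (by positivity : (0 : ℝ) < b), Real.rpow_ofNat, Real.rpow_neg (by positivity),
    Real.rpow_neg hT.le]
  have h1 : (b : ℝ) ^ (2 * β) ≠ 0 := by positivity
  have h2 : (t * ‖z‖) ^ (2 * β + 2) ≠ 0 := by positivity
  field_simp

theorem density_critical_eq_zero {b : ℕ} (hb : 2 ≤ b) (L : Submodule ℤ ℂ) {z : ℂ}
    (hz : ‖z‖ < 1 / (b : ℝ) * systole L) : density (1 / (b : ℝ)) (1 - 1 / b) L z = 0 := by
  have hb2 : (2 : ℝ) ≤ b := by exact_mod_cast hb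
  have hβ : (0 : ℝ) < b / (b - 1) := div_pos (by linarith) (by linarith)
  rw [density_critical hb, latticeSum_eq_sum (F := ∅) (by positivity) (by simp)]
  · simp
  · intro p hp h0 hle
    have := systole_le_norm L hp h0
    rw [one_div_mul_eq_div, lt_div_iff₀ (by linarith)] at hz
    linarith

/-- The critical density, scaled by `ε`, is the sum of the contributions of the lattice points. -/
theorem density_critical_eq_sum_singleDensity {b : ℕ} (hb : 2 ≤ b) {ε N : ℝ} (hε : 0 < ε)
    (hN : 0 < N) {z : ℂ} {F : Finset ℂ} (hFL : ∀ p ∈ F, p ∈ L)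
    (hF : ∀ p ∈ L, p ≠ 0 → ε * ‖p‖ ≤ b * ‖z‖ → p ∈ F) :
    density (1 / (b : ℝ)) (1 - 1 / b) L (ε⁻¹ • z) =
      1 / b * ε ^ 2 / N ^ 2 * ∑ p ∈ F, singleDensity b N (ε * ‖p‖ / b) ‖z‖ := by
  have hb2 : (2 : ℝ) ≤ b := by exact_mod_cast hb
  have hb0 : (0 : ℝ) < b := by linarith
  have hβ : (0 : ℝ) < b / (b - 1) := div_pos (by linarith) (by linarith)
  have hn : ‖ε⁻¹ • z‖ = ε⁻¹ * ‖z‖ := by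
    rw [norm_smul, Real.norm_of_nonneg (by positivity)]
  have hiff (p : ℂ) : ‖p‖ ≤ b * (ε⁻¹ * ‖z‖) ↔ ε * ‖p‖ / b ≤ ‖z‖ := by
    rw [div_le_iff₀ hb0, ← mul_le_mul_iff_right₀ hε]
    rw [show ε * (b * (ε⁻¹ * ‖z‖)) = ‖z‖ * b by field_simp]
  rw [density_critical hb, hn, latticeSum_eq_sum (F := F) (by positivity) hFL]
  · rw [Finset.mul_sum, Finset.mul_sum]
    refine Finset.sum_congr rfl fun p _ => ?_
    unfold singleDensity
    set β : ℝ := b / (b - 1)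
    by_cases hle : ‖p‖ ≤ b * (ε⁻¹ * ‖z‖)
    · rw [if_pos hle, Set.indicator_of_mem (by exact (hiff p).1 hle)]
      rw [Real.mul_rpow (inv_nonneg.2 hε.le) (norm_nonneg z), Real.inv_rpow hε.le,
        Real.rpow_neg hε.le, inv_inv, Real.rpow_add hε, Real.rpow_ofNat,
        Real.div_rpow (by positivity) hb0.le, Real.mul_rpow hε.le (norm_nonneg p),
        Real.rpow_neg hb0.le]
      field_simp
    · rw [if_neg hle, Set.indicator_of_notMem (by exact fun h' => hle ((hiff p).2 h'))]
      simp
  · intro p hp h0 hle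
    refine hF p hp h0 ?_
    have := (hiff p).1 hle
    rw [div_le_iff₀ hb0] at this
    linarith

end Tiling

/-! ### The main estimate -/

/-- The sum of `f (a (v - u))` over the `b`-th roots `u` of `m` and `v` of `n`. -/
noncomputable def rootPairSum (b : ℕ) (f : ℂ → ℂ) (a : ℝ) (m n : ℂ) : ℂ :=
  ∑ u ∈ Polynomial.nthRootsFinset b m, ∑ v ∈ Polynomial.nthRootsFinset b n, f (a * (v - u))

/-- Pairs of distinct points are parametrised by their first point and their difference. -/
theorem sum_pairs_eq_sum_differences {E : Type*} [AddCommMonoid E] {L : Submodule ℤ ℂ} {z₀ : ℂ}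
    {F P : Finset ℂ} (hF : (F : Set ℂ) ⊆ grid L z₀) (hP : ∀ p, p ∈ P → p ≠ 0)
    (hFP : ∀ p ∈ L, p ≠ 0 → (∃ m ∈ F, m + p ∈ F) → p ∈ P) (T : ℂ → ℂ → E) :
    ∑ m ∈ F, ∑ n ∈ F with n ≠ m, T m n = ∑ p ∈ P, ∑ m ∈ F with m + p ∈ F, T m (m + p) := by
  classical
  have h1 : ∀ m ∈ F, ∑ n ∈ F with n ≠ m, T m n = ∑ p ∈ P with m + p ∈ F, T m (m + p) := by
    intro m hm
    refine Finset.sum_bij' (fun n _ => n - m) (fun p _ => m + p) ?_ ?_ ?_ ?_ ?_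
    · intro n hn
      rw [Finset.mem_filter] at hn ⊢
      rw [add_sub_cancel]
      refine ⟨hFP _ ?_ (sub_ne_zero.2 hn.2) ⟨m, hm, ?_⟩, hn.1⟩
      · obtain ⟨p, hp, rfl⟩ := hF hm
        obtain ⟨q, hq, hn'⟩ := hF hn.1
        rw [hn', add_sub_add_left_eq_sub]
        exact sub_mem hq hp
      · rw [add_sub_cancel]
        exact hn.1
    · intro p hp
      rw [Finset.mem_filter] at hp ⊢
      exact ⟨hp.2, by simpa using hP p hp.1⟩
    · intro n _
      exact add_sub_cancel _ _
    · intro p _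
      exact add_sub_cancel_left _ _
    · intro n _
      rw [add_sub_cancel]
  rw [Finset.sum_congr rfl h1]
  refine Finset.sum_comm' fun m p => ?_
  simp only [Finset.mem_filter]
  tauto

/-- The contribution of a fixed difference `p`, compared with the linearised integral. -/
theorem exists_norm_sum_rootPairSum_sub_integral_le (b : ℕ) (hb : 2 ≤ b) {S : Set ℂ} {D : ℝ}
    {fl : ℂ → ℂ} (hS : IsUnitTiling S D fl) (hD : 1 ≤ D) {σ : ℝ} (hσ : 0 < σ) :
    ∃ κ : ℝ, 0 < κ ∧ ∀ (f : ℂ → ℂ) (A M K η : ℝ), IsTestFunction f A M K η → 1 ≤ A →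
      ∀ ε ν N : ℝ, 0 < ν → N = ν ^ b → 0 < ε → D ≤ N → κ * A ≤ ε * ν ^ (b - 1) →
      ∀ (p : ℂ) (F : Finset ℂ), σ ≤ ‖p‖ →
      (∀ m, m ∈ F ↔ m ∈ S ∧ m ≠ 0 ∧ m + p ≠ 0 ∧ ‖m‖ ≤ N ∧ ‖m + p‖ ≤ N) →
      ‖∑ m ∈ F, rootPairSum b f (ε * ν ^ (b - 1)) m (m + p) -
          ∫ x in Metric.closedBall 0 N, linRootSum b f (ε * ν ^ (b - 1)) p x‖ ≤
        if ε * ‖p‖ ≤ 2 * b * A then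
          8 * Real.pi * b * N ^ 2 * pairError b (1 + D / σ) A K η N ε p +
            8 * b * Real.pi * (1 + 2 * D / σ) * M * N * ‖p‖
        else 0 := by
  obtain ⟨κ, hκ, hlin⟩ := exists_norm_sum_roots_sub_le b hb
  obtain ⟨σ', hσ', hmin⟩ := hS.exists_pos_le_norm
  have hb1 : (1 : ℝ) ≤ b := by exact_mod_cast (by omega : 1 ≤ b)
  refine ⟨κ / min 1 σ' + 7 * b * (1 + D / σ), by positivity, ?_⟩
  intro f A M K η hf hA ε ν N hν hN hε hDN hlarge p F hp hF
  have hA0 : 0 ≤ A := by linarith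
  have hK := hf.K_nonneg
  have hη := hf.η_nonneg
  have hM := hf.M_nonneg
  have hp0 : 0 < ‖p‖ := hσ.trans_le hp
  have hN0 : 0 < N := by linarith
  have hπ := Real.pi_pos
  set a := ε * ν ^ (b - 1) with ha
  have ha0 : 0 < a := by positivity
  have hl1 : κ * A ≤ a * min 1 σ' := by
    have h1 : κ / min 1 σ' * A ≤ a := by
      refine le_trans ?_ hlarge
      gcongr
      have : 0 ≤ 7 * b * (1 + D / σ) := by positivity
      linarith
    rwa [div_mul_eq_mul_div, div_le_iff₀ (by positivity)] at h1
  have hl2 : 7 * b * (1 + D / σ) * A ≤ a := by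
    refine le_trans ?_ hlarge
    gcongr
    have : 0 ≤ κ / min 1 σ' := by positivity
    linarith
  have he0 := pairError_nonneg (b := b) (c := 1 + D / σ) (ε := ε) (by positivity) hA0 hK hη hN0.le p
  set e := pairError b (1 + D / σ) A K η N ε p with he
  have hterm : ∀ m ∈ F, ‖rootPairSum b f a m (m + p) - linRootSum b f a p m‖ ≤
      if ε * ‖p‖ ≤ 2 * b * A then b * e else 0 := by
    intro m hm
    obtain ⟨hmS, hm0, -, hmN, -⟩ := (hF m).1 hm
    unfold rootPairSum linRootSum
    rw [← Finset.sum_sub_distrib]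
    have hu : ∀ u ∈ Polynomial.nthRootsFinset b m,
        ‖∑ v ∈ Polynomial.nthRootsFinset b (m + p), f (a * (v - u)) -
          f (a * p / (b * u ^ (b - 1)))‖ ≤ if ε * ‖p‖ ≤ 2 * b * A then e else 0 := by
      intro u hu
      rw [Polynomial.mem_nthRootsFinset (by omega)] at hu
      have hub : ‖u‖ ^ b = ‖m‖ := by rw [← hu, norm_pow]
      have hu0 : u ≠ 0 := by
        rintro rfl
        rw [zero_pow (by omega)] at hu
        exact hm0 hu.symm
      have hun : 0 < ‖u‖ := norm_pos_iff.2 hu0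
      have hmin' : min 1 σ' ≤ ‖u‖ := by
        rcases le_total 1 ‖u‖ with h1 | h1
        · exact (min_le_left _ _).trans h1
        · refine (min_le_right _ _).trans ((hmin m hmS hm0).trans ?_)
          rw [← hub]
          exact pow_le_of_le_one hun.le h1 (by omega)
      have huν : ‖u‖ ≤ ν := by
        rw [← pow_le_pow_iff_left₀ hun.le hν.le (by omega : b ≠ 0), hub, ← hN]
        exact hmN
      have h2 := hlin f A M K η a u p hf hA0 ha0 hu0 (hl1.trans (by gcongr))
      rw [hu] at h2
      refine h2.trans ?_
      split_ifs with hc1 hc2 hc2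
      · have hq : 4 * b * ‖p‖ ≤ 6 * b * (1 + D / σ) * ‖p‖ := by
          have h3 : 0 ≤ D / σ := by positivity
          have h4 : 0 ≤ (b : ℝ) * ‖p‖ := by positivity
          nlinarith
        exact (le_pairError (η := η) hb hA0 hK hν hN hun huν hε hp0 (by positivity) hq hc1
          hp0.le).2
      · have hq : (0 : ℝ) * 0 ≤ 6 * b * (1 + D / σ) * ‖p‖ := by
          rw [zero_mul]
          positivity
        exact absurd (le_pairError (η := η) hb hA0 hK hν hN hun huν hε hp0 le_rfl hq hc1
          le_rfl).1 hc2
      · exact he0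
      · exact le_rfl
    refine (norm_sum_le_of_le _ hu).trans ?_
    rw [Finset.sum_const, nsmul_eq_mul]
    split_ifs
    · gcongr
      exact card_nthRootsFinset_le b m
    · simp
  have hFS : (F : Set ℂ) ⊆ S := fun m hm => ((hF m).1 hm).1
  have hcard : (F.card : ℝ) ≤ 4 * Real.pi * N ^ 2 := by
    refine (hS.card_le hFS fun m hm => ((hF m).1 hm).2.2.2.1).trans ?_
    have h1 : (N + D) ^ 2 ≤ (N + N) ^ 2 := by gcongr
    nlinarith
  have h1 : ‖∑ m ∈ F, rootPairSum b f a m (m + p) - ∑ m ∈ F, linRootSum b f a p m‖ ≤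
      if ε * ‖p‖ ≤ 2 * b * A then 4 * Real.pi * N ^ 2 * (b * e) else 0 := by
    rw [← Finset.sum_sub_distrib]
    refine (norm_sum_le_of_le _ hterm).trans ?_
    rw [Finset.sum_const, nsmul_eq_mul]
    split_ifs
    · gcongr
    · simp
  have h2 := norm_sum_linRootSum_sub_integral_le hf hA hb hS hD hν hN hε hσ hDN hl2 hp hF
  refine (norm_sub_le_norm_sub_add_norm_sub _ _ _).trans ((add_le_add h1 h2).trans ?_)
  split_ifs
  · linarith
  · simp

/-- The sum of the error terms over all differences which contribute. -/
theorem sum_error_le {L : Submodule ℤ ℂ} {D : ℝ} {fl : ℂ → ℂ} (h : IsUnitTiling (L : Set ℂ) D fl)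
    {b : ℕ} {σ A M K η N ε : ℝ} (hb : 2 ≤ b) (hσ : 0 < σ) (hA : 1 ≤ A) (hM : 0 ≤ M) (hK : 0 ≤ K)
    (hη : 0 ≤ η) (hN : 0 < N) (hε : 0 < ε) {P : Finset ℂ} (hPL : (P : Set ℂ) ⊆ L)
    (hσP : ∀ p ∈ P, σ ≤ ‖p‖) (hP : ∀ p ∈ P, ε * ‖p‖ ≤ 2 * b * A) :
    1 / b * ε ^ 2 / N ^ 2 * ∑ p ∈ P, (8 * Real.pi * b * N ^ 2 *
        pairError b (1 + D / σ) A K η N ε p +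
          8 * b * Real.pi * (1 + 2 * D / σ) * M * N * ‖p‖) ≤
      1000 * Real.pi ^ 2 * b ^ 4 * (1 + 2 * D / σ) ^ 3 * (A ^ 4 * ((M + K) / (N * ε) + η)) := by
  have hπ := Real.pi_pos
  have hD := h.D_nonneg
  have hb1 : (1 : ℝ) ≤ b := by exact_mod_cast (by omega : 1 ≤ b)
  have hb0 : (0 : ℝ) < b := by linarith
  set c := 1 + D / σ with hc
  have hDσ : 0 ≤ D / σ := by positivity
  have hc1 : 1 ≤ c := by linarith
  set c' := 1 + 2 * D / σ with hc'
  have hcc : c ≤ c' := by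
    rw [hc, hc', mul_div_assoc]
    linarith
  set T := 2 * b * A / ε with hT
  have hT0 : 0 < T := by positivity
  have hPT : ∀ p ∈ P, ‖p‖ ≤ T := fun p hp => by
    rw [hT, le_div_iff₀ hε]
    linarith [hP p hp]
  have hcard := card_le_of_le_norm h hσ hPL hσP hPT
  have hinv := sum_inv_norm_le_of_le_norm h hσ hT0.le hPL hσP hPT
  have hsum : ∑ p ∈ P, ‖p‖ ≤ Real.pi * c ^ 2 * T ^ 3 := by
    calc ∑ p ∈ P, ‖p‖ ≤ ∑ p ∈ P, T := Finset.sum_le_sum hPT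
      _ = P.card * T := by rw [Finset.sum_const, nsmul_eq_mul]
      _ ≤ Real.pi * c ^ 2 * T ^ 2 * T := by gcongr
      _ = _ := by ring
  set E := 24 * b ^ 3 * c * (K * A ^ 3 / (N * ε ^ 2)) with hE
  have hE0 : 0 ≤ E := by positivity
  have hexp : ∑ p ∈ P, (8 * Real.pi * b * N ^ 2 * pairError b c A K η N ε p +
      8 * b * Real.pi * c' * M * N * ‖p‖) = 8 * Real.pi * b * N ^ 2 * (P.card * η +
        E * ∑ p ∈ P, ‖p‖⁻¹) + 8 * b * Real.pi * c' * M * N * ∑ p ∈ P, ‖p‖ := by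
    rw [Finset.sum_add_distrib, ← Finset.mul_sum, ← Finset.mul_sum]
    unfold pairError
    rw [Finset.sum_add_distrib, ← Finset.mul_sum, Finset.sum_const, nsmul_eq_mul]
  rw [hexp]
  have hstep : 1 / b * ε ^ 2 / N ^ 2 * (8 * Real.pi * b * N ^ 2 * (P.card * η +
        E * ∑ p ∈ P, ‖p‖⁻¹) + 8 * b * Real.pi * c' * M * N * ∑ p ∈ P, ‖p‖) ≤
      1 / b * ε ^ 2 / N ^ 2 * (8 * Real.pi * b * N ^ 2 * (Real.pi * c ^ 2 * T ^ 2 * η +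
        E * (2 * Real.pi * c ^ 2 * T)) + 8 * b * Real.pi * c' * M * N *
          (Real.pi * c ^ 2 * T ^ 3)) := by
    gcongr
  refine hstep.trans ?_
  have heq : 1 / b * ε ^ 2 / N ^ 2 * (8 * Real.pi * b * N ^ 2 * (Real.pi * c ^ 2 * T ^ 2 * η +
        E * (2 * Real.pi * c ^ 2 * T)) + 8 * b * Real.pi * c' * M * N *
          (Real.pi * c ^ 2 * T ^ 3)) =
      32 * Real.pi ^ 2 * (b ^ 2 * c ^ 2 * A ^ 2 * η) +
      768 * Real.pi ^ 2 * (b ^ 4 * c ^ 3 * A ^ 4 * (K / (N * ε))) +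
      64 * Real.pi ^ 2 * (b ^ 3 * (c ^ 2 * c') * A ^ 3 * (M / (N * ε))) := by
    rw [hE, hT]
    field_simp
    ring
  rw [heq]
  have hc'1 : 1 ≤ c' := hc1.trans hcc
  have i1 : b ^ 2 * c ^ 2 * A ^ 2 * η ≤ b ^ 4 * c' ^ 3 * A ^ 4 * η := by
    have : c ^ 2 ≤ c' ^ 3 :=
      (pow_le_pow_left₀ (by linarith) hcc 2).trans (pow_le_pow_right₀ hc'1 (by norm_num))
    gcongr <;> first | assumption | norm_num
  have i2 : b ^ 4 * c ^ 3 * A ^ 4 * (K / (N * ε)) ≤ b ^ 4 * c' ^ 3 * A ^ 4 * (K / (N * ε)) := by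
    gcongr
  have i3 : b ^ 3 * (c ^ 2 * c') * A ^ 3 * (M / (N * ε)) ≤
      b ^ 4 * c' ^ 3 * A ^ 4 * (M / (N * ε)) := by
    have : c ^ 2 * c' ≤ c' ^ 3 := by
      rw [pow_succ c' 2]
      gcongr
    gcongr <;> first | assumption | norm_num
  have hX1 : 0 ≤ b ^ 4 * c' ^ 3 * A ^ 4 * η := by positivity
  have hX2 : 0 ≤ b ^ 4 * c' ^ 3 * A ^ 4 * (K / (N * ε)) := by positivity
  have hX3 : 0 ≤ b ^ 4 * c' ^ 3 * A ^ 4 * (M / (N * ε)) := by positivity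
  have hπ2 : 0 < Real.pi ^ 2 := by positivity
  calc _ ≤ 32 * Real.pi ^ 2 * (b ^ 4 * c' ^ 3 * A ^ 4 * η) +
      768 * Real.pi ^ 2 * (b ^ 4 * c' ^ 3 * A ^ 4 * (K / (N * ε))) +
      64 * Real.pi ^ 2 * (b ^ 4 * c' ^ 3 * A ^ 4 * (M / (N * ε))) := by gcongr
    _ ≤ 1000 * Real.pi ^ 2 * (b ^ 4 * c' ^ 3 * A ^ 4 * η) +
      1000 * Real.pi ^ 2 * (b ^ 4 * c' ^ 3 * A ^ 4 * (K / (N * ε))) +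
      1000 * Real.pi ^ 2 * (b ^ 4 * c' ^ 3 * A ^ 4 * (M / (N * ε))) := by
        gcongr <;> norm_num
    _ = _ := by ring

/-- The effective statement behind all cases. Here `N = ν ^ b`, the scaling is
`a = N ^ γ = ε ν ^ (b - 1)`, so that `ε = N ^ (γ - (1 - α))`, and the limit density is the critical
one evaluated at `z / ε`. -/
theorem exists_norm_pairCorrelation_sub_le (b : ℕ) (hb : 2 ≤ b) (L : Submodule ℤ ℂ)
    [DiscreteTopology L] [IsZLattice ℝ L] (hL : ZLattice.covolume L volume = 1) (z₀ : ℂ) :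
    ∃ C κ : ℝ, 0 < C ∧ 0 < κ ∧ ∀ (f : ℂ → ℂ) (A M K η : ℝ), IsTestFunction f A M K η → 1 ≤ A →
      ∀ ε ν N : ℝ, 0 < ν → N = ν ^ b → 0 < ε → κ ≤ N → κ * A ≤ ε * ν ^ (b - 1) →
      ∀ F : Finset ℂ, (∀ m, m ∈ F ↔ m ∈ grid L z₀ ∧ m ≠ 0 ∧ ‖m‖ ≤ N) →
      ‖((1 / b * ε ^ 2 / N ^ 2 : ℝ) : ℂ) *
          ∑ m ∈ F, ∑ n ∈ F with n ≠ m, rootPairSum b f (ε * ν ^ (b - 1)) m n -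
          ∫ z, f z * (density (1 / (b : ℝ)) (1 - 1 / b) L (ε⁻¹ • z) : ℂ)‖ ≤
        C * (A ^ 4 * ((M + K) / (N * ε) + η)) := by
  classical
  obtain ⟨D₁, fl₁, hD₁, hgrid⟩ := exists_isUnitTiling_grid L hL z₀
  obtain ⟨D, fl, hD, hlat⟩ := exists_isUnitTiling_grid L hL 0
  rw [grid_zero] at hlat
  obtain ⟨σ, hσ, hσL⟩ := hlat.exists_pos_le_norm
  -- One constant for both tilings.
  have htil : IsUnitTiling (grid L z₀) (max D D₁) fl₁ :=
    ⟨hgrid.mem, fun x => (hgrid.norm_sub_le x).trans (le_max_right _ _),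
      hgrid.measurableSet_fiber, hgrid.volume_fiber⟩
  have hlat' : IsUnitTiling (L : Set ℂ) (max D D₁) fl :=
    ⟨hlat.mem, fun x => (hlat.norm_sub_le x).trans (le_max_left _ _),
      hlat.measurableSet_fiber, hlat.volume_fiber⟩
  set D' := max D D₁
  have hD' : 1 ≤ D' := hD.trans (le_max_left _ _)
  obtain ⟨κ, hκ, hmain⟩ := exists_norm_sum_rootPairSum_sub_integral_le b hb htil hD' hσ
  have hπ := Real.pi_pos
  have hb0 : (0 : ℝ) < b := by exact_mod_cast (by omega : 0 < b)
  refine ⟨1000 * Real.pi ^ 2 * b ^ 4 * (1 + 2 * D' / σ) ^ 3, κ + D', by positivity,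
    by positivity, ?_⟩
  intro f A M K η hf hA ε ν N hν hN hε hN1 hlarge F hF
  have hN0 : 0 < N := by rw [hN]; positivity
  have hDN : D' ≤ N := by linarith
  have hκA : κ * A ≤ ε * ν ^ (b - 1) := by
    refine le_trans ?_ hlarge
    gcongr
    linarith
  set a := ε * ν ^ (b - 1)
  -- Large enough to contain all differences of points of `F`, and all `p` whose density does not
  -- vanish on the support of `f`.
  set P := hlat.points (2 * N + 2 * b * A / ε)
  have hPL : ∀ p ∈ P, p ∈ L := fun p hp => (hlat.mem_points.1 hp).1
  have hP0 : ∀ p ∈ P, p ≠ 0 := fun p hp => (hlat.mem_points.1 hp).2.2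
  have hσP : ∀ p ∈ P, σ ≤ ‖p‖ := fun p hp => hσL p (hPL p hp) (hP0 p hp)
  have hquot : 0 ≤ 2 * b * A / ε := by positivity
  rw [sum_pairs_eq_sum_differences (P := P) (fun m hm => ((hF m).1 hm).1) hP0 ?_]
  swap
  · rintro p hp h0 ⟨m, hm, hmp⟩
    refine hlat.mem_points.2 ⟨hp, ?_, h0⟩
    have h1 := norm_sub_le (m + p) m
    rw [add_sub_cancel_left] at h1
    linarith [((hF _).1 hm).2.2, ((hF _).1 hmp).2.2]
  have hint : ∫ z, f z * (density (1 / (b : ℝ)) (1 - 1 / b) L (ε⁻¹ • z) : ℂ) =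
      ((1 / b * ε ^ 2 / N ^ 2 : ℝ) : ℂ) *
        ∑ p ∈ P, ∫ x in Metric.closedBall 0 N, linRootSum b f a p x := by
    have h1 : ∀ p ∈ P, ∫ x in Metric.closedBall 0 N, linRootSum b f a p x =
        ∫ z, f z * (singleDensity b N (ε * ‖p‖ / b) ‖z‖ : ℂ) := fun p hp =>
      integral_linRootSum hf hb hν hN hε (hP0 p hp)
    rw [Finset.sum_congr rfl h1, ← integral_finsetSum _ fun p hp =>
      integrable_mul_singleDensity hf hb N (div_pos (mul_pos hε (hσ.trans_le (hσP p hp))) hb0),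
      ← integral_const_mul]
    refine integral_congr_ae (Eventually.of_forall fun z => ?_)
    simp only
    rw [← Finset.mul_sum]
    rcases le_or_gt A ‖z‖ with hz | hz
    · rw [hf.eq_zero z hz]
      ring
    · rw [density_critical_eq_sum_singleDensity hb hε hN0 hPL]
      · push_cast
        ring
      · intro p hp h0 hle
        refine hlat.mem_points.2 ⟨hp, ?_, h0⟩
        have h2 : ‖p‖ ≤ 2 * b * A / ε := by
          rw [le_div_iff₀ hε]
          have : b * ‖z‖ ≤ b * A := by gcongr
          have : 0 ≤ b * A := by positivity
          linarith
        linarith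
  rw [hint, ← mul_sub, norm_mul, Complex.norm_real, Real.norm_of_nonneg (by positivity),
    ← Finset.sum_sub_distrib]
  have hpt : ∀ p ∈ P, ‖∑ m ∈ F with m + p ∈ F, rootPairSum b f a m (m + p) -
      ∫ x in Metric.closedBall 0 N, linRootSum b f a p x‖ ≤ _ := fun p hp =>
    hmain f A M K η hf hA ε ν N hν hN hε hDN hκA p (F.filter fun m => m + p ∈ F) (hσP p hp) <| by
      intro m
      rw [Finset.mem_filter, hF, hF]
      constructor
      · rintro ⟨⟨h1, h2, h3⟩, -, h4, h5⟩
        exact ⟨h1, h2, h4, h3, h5⟩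
      · rintro ⟨h1, h2, h3, h4, h5⟩
        refine ⟨⟨h1, h2, h4⟩, ?_, h3, h5⟩
        obtain ⟨q, hq, rfl⟩ := h1
        exact ⟨q + p, add_mem hq (hPL p hp), add_assoc _ _ _⟩
  refine (mul_le_mul_of_nonneg_left (norm_sum_le_of_le _ hpt) (by positivity)).trans ?_
  rw [← Finset.sum_filter]
  refine sum_error_le hlat' hb hσ hA hf.M_nonneg hf.K_nonneg hf.η_nonneg hN0 hε ?_ ?_ ?_
  · intro p hp
    exact hPL p (Finset.mem_filter.1 hp).1
  · intro p hp
    exact hσP p (Finset.mem_filter.1 hp).1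
  · intro p hp
    exact (Finset.mem_filter.1 hp).2

section

/-! ### The empirical measures as finite sums -/

theorem exists_finset_points {S : Set ℂ} {D : ℝ} {fl : ℂ → ℂ} (hS : IsUnitTiling S D fl) (N : ℕ) :
    ∃ F : Finset ℂ, ∀ m, m ∈ F ↔ m ∈ S ∧ m ≠ 0 ∧ ‖m‖ ≤ N := by
  refine ⟨((hS.finite_inter_closedBall N).sdiff (t := {0})).toFinset, fun m => ?_⟩
  simp only [Set.Finite.mem_toFinset, Set.mem_sdiff, Set.mem_inter_iff, mem_closedBall_zero_iff,
    Set.mem_singleton_iff]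
  tauto

theorem mem_pairs_iff {S : Set ℂ} {N : ℕ} {F : Finset ℂ}
    (hF : ∀ m, m ∈ F ↔ m ∈ S ∧ m ≠ 0 ∧ ‖m‖ ≤ N) (x : ℂ × ℂ) :
    x ∈ (F ×ˢ F).filter (fun x => x.1 ≠ x.2) ↔
      x.1 ∈ S ∧ x.2 ∈ S ∧ x.1 ≠ x.2 ∧ 0 < ‖x.1‖ ∧ ‖x.1‖ ≤ N ∧ 0 < ‖x.2‖ ∧ ‖x.2‖ ≤ N := by
  rw [Finset.mem_filter, Finset.mem_product, hF, hF, norm_pos_iff, norm_pos_iff]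
  tauto

theorem mem_rootPairs_iff {b : ℕ} (hb : 0 < b) {n m : ℂ} (hn : n ≠ 0) (hm : m ≠ 0) (w : ℂ × ℂ) :
    w ∈ Polynomial.nthRootsFinset b m ×ˢ Polynomial.nthRootsFinset b n ↔
      w.1 ≠ 0 ∧ w.2 ≠ 0 ∧ w.1 ^ b = m ∧ w.2 ^ b = n := by
  rw [Finset.mem_product, Polynomial.mem_nthRootsFinset hb, Polynomial.mem_nthRootsFinset hb]
  constructor
  · rintro ⟨h1, h2⟩
    refine ⟨?_, ?_, h1, h2⟩
    · rintro h
      rw [h, zero_pow hb.ne'] at h1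
      exact hm h1.symm
    · rintro h
      rw [h, zero_pow hb.ne'] at h2
      exact hn h2.symm
  · rintro ⟨-, -, h1, h2⟩
    exact ⟨h1, h2⟩

/-- The empirical measure is a finite combination of Dirac masses. -/
theorem empiricalMeasure_eq_sum {b : ℕ} (hb : 0 < b) (γ : ℝ) {S : Set ℂ} {N : ℕ} {F : Finset ℂ}
    (hF : ∀ m, m ∈ F ↔ m ∈ S ∧ m ≠ 0 ∧ ‖m‖ ≤ N) :
    empiricalMeasure b γ S N =
      ENNReal.ofReal ((1 / (b : ℝ)) / (N : ℝ) ^ (2 * (2 - 1 / (b : ℝ) - γ))) •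
        ∑ x ∈ (F ×ˢ F).filter (fun x => x.1 ≠ x.2),
          ∑ w ∈ Polynomial.nthRootsFinset b x.2 ×ˢ Polynomial.nthRootsFinset b x.1,
            Measure.dirac ((((N : ℝ) ^ γ : ℝ) : ℂ) * (w.2 - w.1)) := by
  unfold empiricalMeasure
  congr 1
  let _ : Fintype (PointPair S N) := Fintype.subtype _ (mem_pairs_iff hF)
  rw [Measure.sum_fintype, Finset.sum_subtype _ (mem_pairs_iff hF)]
  refine Finset.sum_congr rfl fun x _ => ?_
  have hx1 : x.1.1 ≠ 0 := norm_pos_iff.1 x.2.2.2.2.1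
  have hx2 : x.1.2 ≠ 0 := norm_pos_iff.1 x.2.2.2.2.2.2.1
  let _ : Fintype (RootPair b x.1.1 x.1.2) := Fintype.subtype _ (mem_rootPairs_iff hb hx1 hx2)
  rw [Measure.sum_fintype, Finset.sum_subtype _ (mem_rootPairs_iff hb hx1 hx2)]
  rfl

theorem isFiniteMeasure_empiricalMeasure {b : ℕ} (hb : 0 < b) (γ : ℝ) {S : Set ℂ} {N : ℕ}
    {F : Finset ℂ} (hF : ∀ m, m ∈ F ↔ m ∈ S ∧ m ≠ 0 ∧ ‖m‖ ≤ N) :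
    IsFiniteMeasure (empiricalMeasure b γ S N) := by
  rw [empiricalMeasure_eq_sum hb γ hF]
  refine ⟨?_⟩
  simp only [Measure.smul_apply, Measure.coe_finsetSum, Finset.sum_apply, smul_eq_mul]
  refine ENNReal.mul_lt_top ENNReal.ofReal_lt_top (ENNReal.sum_lt_top.2 fun x _ =>
    ENNReal.sum_lt_top.2 fun w _ => ?_)
  exact measure_lt_top _ _

theorem integral_empiricalMeasure {b : ℕ} (hb : 0 < b) (γ : ℝ) {S : Set ℂ} {N : ℕ}
    {F : Finset ℂ} (hF : ∀ m, m ∈ F ↔ m ∈ S ∧ m ≠ 0 ∧ ‖m‖ ≤ N) (f : ℂ → ℂ) :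
    ∫ z, f z ∂(empiricalMeasure b γ S N) =
      (((1 / (b : ℝ)) / (N : ℝ) ^ (2 * (2 - 1 / (b : ℝ) - γ)) : ℝ) : ℂ) *
        ∑ m ∈ F, ∑ n ∈ F with n ≠ m, rootPairSum b f ((N : ℝ) ^ γ) m n := by
  classical
  have hdir (z : ℂ) : Integrable f (Measure.dirac z) := integrable_dirac (by simp)
  rw [empiricalMeasure_eq_sum hb γ hF, integral_smul_measure, ENNReal.toReal_ofReal (by positivity),
    integral_finsetSum_measure fun x _ => integrable_finsetSum_measure.2 fun w _ => hdir _,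
    Complex.real_smul]
  congr 1
  have hx : ∀ x ∈ (F ×ˢ F).filter (fun x => x.1 ≠ x.2),
      ∫ z, f z ∂(∑ w ∈ Polynomial.nthRootsFinset b x.2 ×ˢ Polynomial.nthRootsFinset b x.1,
        Measure.dirac ((((N : ℝ) ^ γ : ℝ) : ℂ) * (w.2 - w.1))) =
      rootPairSum b f ((N : ℝ) ^ γ) x.2 x.1 := by
    intro x _
    rw [integral_finsetSum_measure fun w _ => hdir _]
    simp only [integral_dirac]
    rw [Finset.sum_product]
    rfl
  rw [Finset.sum_congr rfl hx, Finset.sum_filter, Finset.sum_product_right]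
  simp only [Finset.sum_filter]

/-! ### The limit measures -/

variable {L : Submodule ℤ ℂ} {D : ℝ} {fl : ℂ → ℂ}

theorem measurable_density {b : ℕ} (hb : 2 ≤ b) (γ : ℝ) (h : IsUnitTiling (L : Set ℂ) D fl) :
    Measurable (density (1 / (b : ℝ)) γ L) := by
  rcases lt_trichotomy γ (1 - 1 / (b : ℝ)) with hlt | rfl | hgt
  · have : density (1 / (b : ℝ)) γ L = fun _ => Real.pi / ((1 / (b : ℝ)) ^ 2 * (2 - 1 / b)) := by
      funext z
      rw [density, if_neg hlt.not_gt, if_pos hlt]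
    rw [this]
    exact measurable_const
  · exact measurable_density_critical hb h
  · have : density (1 / (b : ℝ)) γ L = fun _ => 0 := by
      funext z
      rw [density, if_pos hgt]
    rw [this]
    exact measurable_const

theorem exists_density_le {b : ℕ} (hb : 2 ≤ b) (γ : ℝ) (h : IsUnitTiling (L : Set ℂ) D fl) :
    ∃ B : ℝ, ∀ z, density (1 / (b : ℝ)) γ L z ≤ B := by
  rcases lt_trichotomy γ (1 - 1 / (b : ℝ)) with hlt | rfl | hgt
  · refine ⟨Real.pi / ((1 / (b : ℝ)) ^ 2 * (2 - 1 / b)), fun z => ?_⟩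
    rw [density, if_neg hlt.not_gt, if_pos hlt]
  · exact exists_density_critical_le hb h
  · refine ⟨0, fun z => ?_⟩
    rw [density, if_pos hgt]

theorem density_nonneg {b : ℕ} (hb : 2 ≤ b) (γ : ℝ) (L : Submodule ℤ ℂ) (z : ℂ) :
    0 ≤ density (1 / (b : ℝ)) γ L z := by
  rcases lt_trichotomy γ (1 - 1 / (b : ℝ)) with hlt | rfl | hgt
  · rw [density, if_neg hlt.not_gt, if_pos hlt]
    have hb2 : (2 : ℝ) ≤ b := by exact_mod_cast hb
    have : 1 / (b : ℝ) ≤ 1 := by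
      rw [div_le_one (by linarith)]
      linarith
    have : 0 ≤ 2 - 1 / (b : ℝ) := by linarith
    have := Real.pi_pos
    positivity
  · exact density_critical_nonneg hb L z
  · rw [density, if_pos hgt]

theorem isLocallyFiniteMeasure_limitMeasure {b : ℕ} (hb : 2 ≤ b) (γ : ℝ)
    (h : IsUnitTiling (L : Set ℂ) D fl) :
    IsLocallyFiniteMeasure (limitMeasure (1 / (b : ℝ)) γ L) := by
  obtain ⟨B, hB⟩ := exists_density_le hb γ h
  refine ⟨fun x => ⟨Metric.ball x 1, Metric.ball_mem_nhds x one_pos, ?_⟩⟩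
  rw [limitMeasure, withDensity_apply _ measurableSet_ball]
  refine lt_of_le_of_lt (lintegral_mono fun z => ENNReal.ofReal_le_ofReal (hB z)) ?_
  rw [setLIntegral_const, Complex.volume_ball]
  finiteness

theorem integral_limitMeasure {b : ℕ} (hb : 2 ≤ b) (γ : ℝ) (h : IsUnitTiling (L : Set ℂ) D fl)
    (f : ℂ → ℂ) : ∫ z, f z ∂(limitMeasure (1 / (b : ℝ)) γ L) =
      ∫ z, f z * (density (1 / (b : ℝ)) γ L z : ℂ) := by
  rw [limitMeasure, integral_withDensity_eq_integral_toReal_smul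
    (measurable_density hb γ h).ennreal_ofReal
    (Eventually.of_forall fun _ => ENNReal.ofReal_lt_top)]
  refine integral_congr_ae (Eventually.of_forall fun z => ?_)
  simp only
  rw [ENNReal.toReal_ofReal (density_nonneg hb γ L z), Complex.real_smul, mul_comm]

/-- The critical density at scale `N ^ (γ - (1 - α))` tends to the limit density, in each of the
three regimes. -/
theorem tendsto_density_scaled {b : ℕ} (hb : 2 ≤ b) (γ : ℝ) (h : IsUnitTiling (L : Set ℂ) D fl)
    {z : ℂ} (hz : z ≠ 0) :
    Tendsto (fun N : ℕ => density (1 / (b : ℝ)) (1 - 1 / b) L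
      (((N : ℝ) ^ (γ - (1 - 1 / (b : ℝ))))⁻¹ • z)) atTop (𝓝 (density (1 / (b : ℝ)) γ L z)) := by
  rcases lt_trichotomy γ (1 - 1 / (b : ℝ)) with hlt | rfl | hgt
  · have hval : density (1 / (b : ℝ)) γ L z = Real.pi / ((1 / (b : ℝ)) ^ 2 * (2 - 1 / b)) := by
      rw [density, if_neg hlt.not_gt, if_pos hlt]
    rw [hval]
    refine (tendsto_density_critical hb h hz).comp ?_
    refine ((tendsto_rpow_atTop (sub_pos.2 hlt)).comp tendsto_natCast_atTop_atTop).congr fun N => ?_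
    rw [Function.comp_apply, ← Real.rpow_neg (Nat.cast_nonneg N), neg_sub]
  · simp
  · have hval : density (1 / (b : ℝ)) γ L z = 0 := by rw [density, if_pos hgt]
    rw [hval]
    have hlim : Tendsto (fun N : ℕ => ((N : ℝ) ^ (γ - (1 - 1 / (b : ℝ))))⁻¹ * ‖z‖) atTop (𝓝 0) := by
      have := (((tendsto_rpow_atTop (sub_pos.2 hgt)).comp
        (tendsto_natCast_atTop_atTop (R := ℝ))).inv_tendsto_atTop).mul_const ‖z‖
      rwa [zero_mul] at this
    have hb0 : (0 : ℝ) < b := by exact_mod_cast (by omega : 0 < b)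
    have hpos : 0 < 1 / (b : ℝ) * systole L := mul_pos (by positivity) (systole_pos h)
    refine tendsto_const_nhds.congr' ?_
    filter_upwards [hlim.eventually_lt_const hpos] with N hN
    rw [density_critical_eq_zero hb]
    rwa [norm_smul, Real.norm_of_nonneg (by positivity)]

theorem tendsto_integral_density_scaled {b : ℕ} (hb : 2 ≤ b) (γ : ℝ)
    (h : IsUnitTiling (L : Set ℂ) D fl) {f : ℂ → ℂ} (hf : Integrable f) :
    Tendsto (fun N : ℕ => ∫ z, f z * (density (1 / (b : ℝ)) (1 - 1 / b) L
      (((N : ℝ) ^ (γ - (1 - 1 / (b : ℝ))))⁻¹ • z) : ℂ)) atTop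
      (𝓝 (∫ z, f z * (density (1 / (b : ℝ)) γ L z : ℂ))) := by
  obtain ⟨B, hB⟩ := exists_density_critical_le hb h
  refine tendsto_integral_of_dominated_convergence (fun z => ‖f z‖ * B) (fun N => ?_)
    (hf.norm.mul_const B) (fun N => Eventually.of_forall fun z => ?_) ?_
  · refine hf.1.mul (Measurable.aestronglyMeasurable ?_)
    exact Complex.measurable_ofReal.comp ((measurable_density_critical hb h).comp
      (measurable_const_smul _))
  · rw [norm_mul, Complex.norm_real, Real.norm_of_nonneg (density_critical_nonneg hb L _)]
    exact mul_le_mul_of_nonneg_left (hB _) (norm_nonneg _)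
  · filter_upwards [ae_ne_zero] with z hz
    exact ((Complex.continuous_ofReal.tendsto _).comp
      (tendsto_density_scaled hb γ h hz)).const_mul _

/-! ### Test functions -/

/-- A continuous compactly supported function satisfies the almost Lipschitz condition with any
`η > 0`. -/
theorem exists_isTestFunction {f : ℂ → ℂ} (hf : Continuous f) (hsupp : HasCompactSupport f) :
    ∃ A M : ℝ, 1 ≤ A ∧ ∀ η > 0, ∃ K, IsTestFunction f A M K η := by
  obtain ⟨M, hM⟩ := hsupp.exists_bound_of_continuous hf
  obtain ⟨A, hA⟩ := hsupp.isCompact.isBounded.subset_ball 0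
  have hM0 : 0 ≤ M := (norm_nonneg _).trans (hM 0)
  refine ⟨max 1 A, M, le_max_left _ _, fun η hη => ?_⟩
  obtain ⟨δ, hδ, huc⟩ := Metric.uniformContinuous_iff.1
    (hf.uniformContinuous_of_tendsto_cocompact hsupp.is_zero_at_infty) η hη
  refine ⟨2 * M / δ, hf, hM, fun z hz => ?_, fun z w => ?_, by positivity, hη.le⟩
  · refine image_eq_zero_of_notMem_tsupport fun hmem => ?_
    have := hA hmem
    rw [mem_ball_zero_iff] at this
    exact absurd this (not_lt.2 ((le_max_right _ _).trans hz))
  · rcases lt_or_ge ‖z - w‖ δ with hlt | hge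
    · have := huc (a := z) (b := w) (by rwa [dist_eq_norm])
      rw [dist_eq_norm] at this
      have h0 : 0 ≤ 2 * M / δ * ‖z - w‖ := by positivity
      linarith
    · have h1 : ‖f z - f w‖ ≤ 2 * M := (norm_sub_le _ _).trans (by linarith [hM z, hM w])
      have h2 : 2 * M ≤ 2 * M / δ * ‖z - w‖ := by
        rw [div_mul_eq_mul_div, le_div_iff₀ hδ]
        gcongr
      linarith

theorem isTestFunction_of_contDiff {f : ℂ → ℂ} (hf : ContDiff ℝ 1 f) (hsupp : HasCompactSupport f)
    {A : ℝ} (hA : tsupport f ⊆ Metric.ball 0 A) :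
    IsTestFunction f A (⨆ z, ‖f z‖) (⨆ z, ‖fderiv ℝ f z‖) 0 := by
  have hbf : BddAbove (Set.range fun z => ‖f z‖) :=
    hf.continuous.norm.bddAbove_range_of_hasCompactSupport hsupp.norm
  have hbd : BddAbove (Set.range fun z => ‖fderiv ℝ f z‖) :=
    (hf.continuous_fderiv one_ne_zero).norm.bddAbove_range_of_hasCompactSupport
      (hsupp.fderiv ℝ).norm
  refine ⟨hf.continuous, le_ciSup hbf, fun z hz => ?_, fun z w => ?_,
    Real.iSup_nonneg fun z => norm_nonneg _, le_rfl⟩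
  · refine image_eq_zero_of_notMem_tsupport fun hmem => ?_
    have := hA hmem
    rw [mem_ball_zero_iff] at this
    exact absurd this (not_lt.2 hz)
  · rw [zero_add]
    exact convex_univ.norm_image_sub_le_of_norm_fderiv_le
      (fun x _ => hf.differentiable one_ne_zero x) (fun x _ => le_ciSup hbd x) (Set.mem_univ w)
      (Set.mem_univ z)

/-- The main estimate, in the original parametrisation. -/
theorem exists_norm_integral_empiricalMeasure_sub_le (b : ℕ) (hb : 2 ≤ b) (γ : ℝ)
    (L : Submodule ℤ ℂ) [DiscreteTopology L] [IsZLattice ℝ L]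
    (hL : ZLattice.covolume L volume = 1) (z₀ : ℂ) :
    ∃ C κ : ℝ, 0 < C ∧ 0 < κ ∧ ∀ (f : ℂ → ℂ) (A M K η : ℝ), IsTestFunction f A M K η → 1 ≤ A →
      ∀ N : ℕ, κ ≤ N → κ * A ≤ (N : ℝ) ^ γ →
      ‖(∫ z, f z ∂(empiricalMeasure b γ (grid L z₀) N)) -
          ∫ z, f z * (density (1 / (b : ℝ)) (1 - 1 / b) L
            (((N : ℝ) ^ (γ - (1 - 1 / (b : ℝ))))⁻¹ • z) : ℂ)‖ ≤
        C * (A ^ 4 * ((M + K) / (N : ℝ) ^ (γ + 1 / (b : ℝ)) + η)) := by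
  obtain ⟨C, κ, hC, hκ, hmain⟩ := exists_norm_pairCorrelation_sub_le b hb L hL z₀
  obtain ⟨D, fl, -, htil⟩ := exists_isUnitTiling_grid L hL z₀
  refine ⟨C, κ, hC, hκ, fun f A M K η hf hA N hN hlarge => ?_⟩
  obtain ⟨F, hF⟩ := exists_finset_points htil N
  have hN0 : (0 : ℝ) < N := hκ.trans_le hN
  have hb0 : (b : ℝ) ≠ 0 := by exact_mod_cast (by omega : b ≠ 0)
  set ε : ℝ := (N : ℝ) ^ (γ - (1 - 1 / (b : ℝ))) with hε
  set ν : ℝ := (N : ℝ) ^ (b : ℝ)⁻¹ with hν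
  have hνb : (N : ℝ) = ν ^ b := (Real.rpow_inv_natCast_pow hN0.le (by omega)).symm
  have ha : ε * ν ^ (b - 1) = (N : ℝ) ^ γ := by
    rw [hε, hν, ← Real.rpow_natCast, ← Real.rpow_mul hN0.le, ← Real.rpow_add hN0,
      Nat.cast_sub (by omega)]
    congr 1
    push_cast
    field_simp
    ring
  have hpre : (1 / (b : ℝ)) / (N : ℝ) ^ (2 * (2 - 1 / (b : ℝ) - γ)) =
      1 / b * ε ^ 2 / (N : ℝ) ^ 2 := by
    rw [mul_div_assoc, div_eq_mul_inv (1 / (b : ℝ)), ← Real.rpow_neg hN0.le, hε,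
      ← Real.rpow_natCast (_ ^ _), ← Real.rpow_mul hN0.le, ← Real.rpow_natCast (N : ℝ) 2,
      ← Real.rpow_sub hN0]
    congr 2
    push_cast
    ring
  have hNε : (N : ℝ) ^ (γ + 1 / (b : ℝ)) = N * ε := by
    rw [show γ + 1 / (b : ℝ) = 1 + (γ - (1 - 1 / (b : ℝ))) by ring, Real.rpow_add hN0,
      Real.rpow_one]
  have := hmain f A M K η hf hA ε ν N (Real.rpow_pos_of_pos hN0 _) hνb
    (Real.rpow_pos_of_pos hN0 _) hN (by rwa [ha]) F hF
  rw [integral_empiricalMeasure (by omega) γ hF, hpre, hNε]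
  rwa [ha] at this

end

end RootPairs

theorem mainTheorem5 (b : ℕ) (hb : 2 ≤ b) (γ : ℝ) (hγ0 : 0 < γ) (hγ1 : γ < 1)
    (L : Submodule ℤ ℂ) [DiscreteTopology L] [IsZLattice ℝ L]
    (hL : ZLattice.covolume L volume = 1) (z₀ : ℂ) :
    RootPairs.VaguelyConverges
      (fun N => RootPairs.empiricalMeasure b γ (RootPairs.grid L z₀) N)
      (RootPairs.limitMeasure (1 / (b : ℝ)) γ L) ∧
    (γ = 1 - 1 / (b : ℝ) →
      (0 < RootPairs.systole L ∧
        ∀ z : ℂ, ‖z‖ < 1 / (b : ℝ) * RootPairs.systole L →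
          RootPairs.density (1 / (b : ℝ)) γ L z = 0) ∧
      ∃ C : ℝ, 0 < C ∧ ∀ A : ℝ, 1 < A → ∃ N₀ : ℕ,
        ∀ f : ℂ → ℂ, ContDiff ℝ 1 f → HasCompactSupport f → tsupport f ⊆ Metric.ball 0 A →
          ∀ N : ℕ, N₀ ≤ N →
            ‖(∫ z, f z ∂(RootPairs.empiricalMeasure b γ (RootPairs.grid L z₀) N)) -
                ∫ z, f z * (RootPairs.density (1 / (b : ℝ)) γ L z : ℂ)‖ ≤
              C * (A ^ 4 * ((⨆ z, ‖f z‖) + ⨆ z, ‖fderiv ℝ f z‖) / N)) := by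
  obtain ⟨D₁, fl₁, -, hgrid⟩ := RootPairs.exists_isUnitTiling_grid L hL z₀
  obtain ⟨D, fl, -, hlat⟩ := RootPairs.exists_isUnitTiling_grid L hL 0
  rw [RootPairs.grid_zero] at hlat
  obtain ⟨C, κ, hC, hκ, hmain⟩ :=
    RootPairs.exists_norm_integral_empiricalMeasure_sub_le b hb γ L hL z₀
  have hb0 : (0 : ℝ) < b := by exact_mod_cast (by omega : 0 < b)
  have hpow : Tendsto (fun N : ℕ => (N : ℝ) ^ γ) atTop atTop :=
    (tendsto_rpow_atTop hγ0).comp tendsto_natCast_atTop_atTop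
  have hev (A : ℝ) : ∀ᶠ N : ℕ in atTop, κ ≤ N ∧ κ * A ≤ (N : ℝ) ^ γ :=
    (tendsto_natCast_atTop_atTop.eventually_ge_atTop κ).and (hpow.eventually_ge_atTop _)
  refine ⟨⟨fun N => ?_, RootPairs.isLocallyFiniteMeasure_limitMeasure hb γ hlat,
    fun f hf hsupp => ?_⟩, ?_⟩
  · obtain ⟨F, hF⟩ := RootPairs.exists_finset_points hgrid N
    have := RootPairs.isFiniteMeasure_empiricalMeasure (by omega : 0 < b) γ hF
    infer_instance
  · rw [RootPairs.integral_limitMeasure hb γ hlat]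
    have hlim := RootPairs.tendsto_integral_density_scaled hb γ hlat
      (hf.integrable_of_hasCompactSupport hsupp)
    obtain ⟨A, M, hA, htest⟩ := RootPairs.exists_isTestFunction hf hsupp
    refine (tendsto_iff_of_dist ?_).2 hlim
    rw [Metric.tendsto_nhds]
    intro δ hδ
    have hA0 : 0 < A := by linarith
    -- Half of `δ` is spent on the modulus of continuity, half on the size of `N`.
    obtain ⟨K, hK⟩ := htest (δ / (2 * (C * A ^ 4))) (by positivity)
    have hsmall : Tendsto (fun N : ℕ => C * A ^ 4 * ((M + K) / (N : ℝ) ^ (γ + 1 / (b : ℝ)))) atTop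
        (𝓝 0) := by
      have h1 : Tendsto (fun N : ℕ => (N : ℝ) ^ (γ + 1 / (b : ℝ))) atTop atTop :=
        (tendsto_rpow_atTop (by positivity)).comp tendsto_natCast_atTop_atTop
      simpa using (h1.const_div_atTop (M + K)).const_mul (C * A ^ 4)
    filter_upwards [hev A, hsmall.eventually_lt_const (half_pos hδ)] with N hN hlt
    rw [Real.dist_0_eq_abs, abs_of_nonneg dist_nonneg, dist_eq_norm]
    refine (hmain f A M K _ hK hA N hN.1 hN.2).trans_lt ?_
    have : C * A ^ 4 * (δ / (2 * (C * A ^ 4))) = δ / 2 := by field_simp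
    linarith
  · rintro rfl
    refine ⟨⟨RootPairs.systole_pos hlat, fun z hz => RootPairs.density_critical_eq_zero hb L hz⟩,
      C, hC, fun A hA => ?_⟩
    obtain ⟨N₀, hN₀⟩ := eventually_atTop.1 (hev A)
    refine ⟨N₀, fun f hf hsupp hball N hN => ?_⟩
    obtain ⟨h1, h2⟩ := hN₀ N hN
    have := hmain f A _ _ 0 (RootPairs.isTestFunction_of_contDiff hf hsupp hball) hA.le N h1 h2
    rw [sub_self, Real.rpow_zero, inv_one, sub_add_cancel, Real.rpow_one, add_zero] at this
    simpa only [one_smul, mul_div_assoc] using this
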